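/- Let $\alpha>0$, $\lambda>0$, and let $\gamma_{\alpha,\lambda}$ be a gamma random variable, with density $\frac{\lambda^{\alpha}}{\Gamma(\alpha)}x^{\alpha-1}e^{-\lambda x}1_{(0,\infty)}(x)$. A \emph{background driving Lévy process} of a random variable $X$ is a real càdlàg Lévy process $(Y(t))_{t\ge 0}$ (with $Y(0)=0$) such that $\mathbb{E}[\log(1+|Y(1)|)]<\infty$ and $\int_0^\infty e^{-s}\,dY(s)\stackrel{d}{=}X$. Here $\int_0^\infty e^{-s}\,dY(s)$ is the almost sure limit, as $T\to\infty$, of $\int_{(0,T]}e^{-s}\,dY(s):=e^{-T}Y(T)-Y(0)+\int_0^T e^{-s}Y(s)\,ds$. Then $Y(1)$, considered up to equality in distribution, is called the \emph{background driving variable} of $X$, and $G_X(a):=P(Y(1)\le a)$, $a\in\mathbb{R}$, its \emph{background driving distribution function}. Let $N_\alpha,\mathcal{E}_1(\lambda),\mathcal{E}_2(\lambda),\dots$ be independent random variables, where $N_\alpha$ has the Poisson distribution with parameter $\alpha$ and each $\mathcal{E}_k(\lambda)$ has the exponential distribution with parameter (rate) $\lambda$. Then $\gamma_{\alpha,\lambda}$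 has a background driving Lévy process, and for every such process $Y$ $$Y(1)\stackrel{d}{=}\sum_{k=1}^{N_\alpha}\mathcal{E}_k(\lambda)$$ (the sum being $0$ if $N_\alpha=0$). Moreover, for every continuity point $a\in\mathbb{R}$ of the background driving distribution function $G$ of $\gamma_{\alpha,\lambda}$, $$G(a)=P\Big(\sum_{k=1}^{N_\alpha}\mathcal{E}_k(\lambda)\le a\Big)=\frac12+\frac1\pi\int_0^\infty \exp\Big(-\frac{\alpha(t/\lambda)^2}{1+(t/\lambda)^2}\Big)\,\sin\Big(ta-\frac{\alpha(t/\lambda)}{1+(t/\lambda)^2}\Big)\,\frac{dt}{t},$$ where the integral converges as the improper integral $\lim_{T\to\infty}\int_0^T$; and if in addition $a>0$, then also $$G(a)=e^{-\alpha}+e^{-\alpha}\int_0^{2\sqrt{\alpha\lambda a}} I_1(w)\,e^{-w^2/(4\alpha)}\,dw,\qquad I_1(w)=\sum_{j=0}^\infty\frac{(w/2)^{1+2j}}{j!\,(j+1)!}.$$ -/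

import Mathlib

open MeasureTheory ProbabilityTheory Filter Topology
open scoped NNReal Nat

/-- A real-valued Lévy process on the probability space `(Ω, P)`: it starts from zero, has
independent and stationary increments, and almost all its paths are right-continuous with
left limits. -/
structure IsLevyProcess {Ω : Type*} [MeasurableSpace Ω] (Y : ℝ≥0 → Ω → ℝ) (P : Measure Ω) :
    Prop where
  measurable : ∀ t, Measurable (Y t)
  start_zero : ∀ᵐ ω ∂P, Y 0 ω = 0
  indep_increments : HasIndepIncrements Y P
  stationary_increments : ∀ s t : ℝ≥0, IdentDistrib (fun ω => Y (s + t) ω - Y s ω) (Y t) P P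
  cadlag : ∀ᵐ ω ∂P, ∀ t : ℝ≥0,
    ContinuousWithinAt (fun s => Y s ω) (Set.Ici t) t ∧
      ∃ l : ℝ, Tendsto (fun s => Y s ω) (𝓝[<] t) (𝓝 l)

/-- The pathwise random integral `∫_{(0,T]} e^{-s} dY(s)`, for a process `Y` with càdlàg paths,
defined as usual by integration by parts. -/
noncomputable def expRandomIntegral {Ω : Type*} (Y : ℝ≥0 → Ω → ℝ) (T : ℝ) (ω : Ω) : ℝ :=
  Real.exp (-T) * Y T.toNNReal ω - Y 0 ω + ∫ s in (0 : ℝ)..T, Real.exp (-s) * Y s.toNNReal ω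

/-- `Y` is a background driving Lévy process of a (selfdecomposable) random variable with law
`ν`: `Y` is a Lévy process, `Y(1)` has a finite logarithmic moment, and the random integral
`∫_0^∞ e^{-s} dY(s) = lim_{T → ∞} ∫_{(0,T]} e^{-s} dY(s)` exists almost surely and has law `ν`. -/
structure IsBDLP {Ω : Type*} [MeasurableSpace Ω] (Y : ℝ≥0 → Ω → ℝ) (P : Measure Ω)
    (ν : Measure ℝ) : Prop where
  isLevyProcess : IsLevyProcess Y P
  log_moment : Integrable (fun ω => Real.log (1 + |Y 1 ω|)) P
  integral_representation : ∃ X : Ω → ℝ, HasLaw X ν P ∧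
    ∀ᵐ ω ∂P, Tendsto (fun T : ℝ => expRandomIntegral Y T ω) atTop (𝓝 (X ω))

/-- `W` is (a version in law of) the background driving variable of a random variable with
law `ν`: it has the law of `Y(1)` for some background driving Lévy process `Y` of `ν`. -/
def IsBDRV {Ω : Type*} [MeasurableSpace Ω] (W : Ω → ℝ) (P : Measure Ω) (ν : Measure ℝ) : Prop :=
  ∃ (Ω' : Type) (_ : MeasurableSpace Ω') (P' : Measure Ω') (_ : IsProbabilityMeasure P')
    (Y : ℝ≥0 → Ω' → ℝ), IsBDLP Y P' ν ∧ IdentDistrib W (Y 1) P P'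

/-- The background driving distribution function `a ↦ P(Y(1) ≤ a)`. -/
noncomputable def bddf {Ω : Type*} [MeasurableSpace Ω] (Y : ℝ≥0 → Ω → ℝ) (P : Measure Ω)
    (a : ℝ) : ℝ :=
  P.real {ω | Y 1 ω ≤ a}

/-- The random sum `∑_{k=1}^{N} E_k`; here `E k` is the `(k+1)`-st summand. It is zero where
`N = 0`. -/
def randomSum {Ω : Type*} (N : Ω → ℕ) (E : ℕ → Ω → ℝ) (ω : Ω) : ℝ :=
  ∑ k ∈ Finset.range (N ω), E k ω

/-- The modified Bessel function of the first kind `I_n`, of integer order `n ≥ 0`. -/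
noncomputable def besselI (n : ℕ) (x : ℝ) : ℝ :=
  ∑' j : ℕ, (x / 2) ^ (n + 2 * j) / ((j ! : ℝ) * ((n + j)! : ℝ))

/-- The improper integral `∫_0^∞ f(t) dt = lim_{T → ∞} ∫_0^T f(t) dt` converges to `L`. -/
def HasImproperIntegral (f : ℝ → ℝ) (L : ℝ) : Prop :=
  (∀ T : ℝ, 0 ≤ T → IntervalIntegrable f volume 0 T) ∧
    Tendsto (fun T : ℝ => ∫ t in (0 : ℝ)..T, f t) atTop (𝓝 L)

/-! Write `φ` for the characteristic function of the gamma law, `φ(u) = exp(-α log(1 - iu/λ))`.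

Uniqueness. Let `Y` be any background driving Lévy process and `I_h` its integral over `(0,h]`.
Splitting the integral at `h` gives `φ(u) = E[exp(iu I_h)] φ(e^{-h}u)` (`IsBDLP.charFun_eq_mul`).
Cut `(0,1]` into `n` cells and restart the weight `e^{-s}` on each: the sum of the resulting i.i.d.
copies of `I_{1/n}` tends to `Y(1)`. Hence the characteristic function of `Y(1)` is the limit of
`(φ(u) / φ(e^{-1/n}u))^n`, a logarithmic derivative that equals `exp(α((1 - iu/λ)⁻¹ - 1))`
(`IsBDLP.charFun_gammaMeasure`). This is also the characteristic function of the Poisson sum of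
exponentials.

Existence. A compound Poisson process with rate `α` and exponential jumps is built from independent
unit cells. Integrals of deterministic functions `w` have characteristic exponent `α ∫ (χ(w(s)) - 1)
ds`, with `χ` that of a jump (`phaseMean_jumpIntegral`). Indicators `w` give the Lévy property;
`w(s) = u e^{-s}` gives the gamma law, because `χ(u e^{-s}) - 1` has the antiderivative `log(1 - i u
e^{-s}/λ)`. See `isBDLP_jumpProcess`.

Formulas. The sine integral is Gil-Pelaez inversion (`gilPelaez`), available since `Y(1)` has a
mean. The Bessel integral comes from conditioning on the Poisson count: partial sums are gamma
distributed, their densities add up to a Bessel series, and `w = 2√(αλx)` is substituted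
(`measureReal_randomSum_le`). -/

/-! ### Gamma and exponential laws: moments and characteristic functions. -/

lemma integral_gammaPDFReal {a r : ℝ} (ha : 0 < a) (hr : 0 < r) :
    ∫ x, gammaPDFReal a r x = 1 := by
  rw [integral_eq_lintegral_of_nonneg_ae (ae_of_all _ (gammaPDFReal_nonneg ha hr))
    (stronglyMeasurable_gammaPDFReal a r).aestronglyMeasurable]
  have := lintegral_gammaPDF_eq_one ha hr
  unfold gammaPDF at this
  simp [this]

lemma integrable_gammaPDFReal {a r : ℝ} (ha : 0 < a) (hr : 0 < r) :
    Integrable (gammaPDFReal a r) := by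
  by_contra h
  have := integral_gammaPDFReal ha hr
  rw [integral_undef h] at this
  exact zero_ne_one this

lemma integrable_gammaMeasure_iff {E : Type*} [NormedAddCommGroup E] [NormedSpace ℝ E]
    {a r : ℝ} (ha : 0 < a) (hr : 0 < r) {f : ℝ → E} :
    Integrable f (gammaMeasure a r) ↔ Integrable (fun x => gammaPDFReal a r x • f x) := by
  unfold gammaMeasure
  rw [integrable_withDensity_iff_integrable_smul₀' (by unfold gammaPDF; fun_prop)
    (ae_of_all _ fun x => by simp [gammaPDF])]
  simp [gammaPDF, ENNReal.toReal_ofReal, gammaPDFReal_nonneg ha hr]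

lemma integral_gammaMeasure {E : Type*} [NormedAddCommGroup E] [NormedSpace ℝ E]
    {a r : ℝ} (ha : 0 < a) (hr : 0 < r) (f : ℝ → E) :
    ∫ x, f x ∂(gammaMeasure a r) = ∫ x, gammaPDFReal a r x • f x := by
  unfold gammaMeasure
  rw [integral_withDensity_eq_integral_toReal_smul₀ (by unfold gammaPDF; fun_prop)
    (ae_of_all _ fun x => by simp [gammaPDF])]
  simp [gammaPDF, ENNReal.toReal_ofReal, gammaPDFReal_nonneg ha hr]

/-- Exponential tilting stays in the gamma family; integrability of `exp (t x)` and the value of the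
moment generating function both follow. -/
lemma gammaPDFReal_mul_exp {a r t : ℝ} (hr : 0 < r) (ht : t < r) (x : ℝ) :
    gammaPDFReal a r x * Real.exp (t * x) = (r / (r - t)) ^ a * gammaPDFReal a (r - t) x := by
  unfold gammaPDFReal
  split_ifs
  · have h1 : 0 < r - t := sub_pos.2 ht
    have h2 : 0 < (r - t) ^ a := Real.rpow_pos_of_pos h1 a
    rw [Real.div_rpow hr.le h1.le, show -((r - t) * x) = -(r * x) + t * x by ring, Real.exp_add]
    field_simp
  · simp

lemma integrable_exp_mul_gammaMeasure {a r t : ℝ} (ha : 0 < a) (hr : 0 < r) (ht : t < r) :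
    Integrable (fun x => Real.exp (t * x)) (gammaMeasure a r) := by
  rw [integrable_gammaMeasure_iff ha hr]
  simp_rw [smul_eq_mul, gammaPDFReal_mul_exp hr ht]
  exact (integrable_gammaPDFReal ha (sub_pos.2 ht)).const_mul _

lemma mgf_gammaMeasure {a r t : ℝ} (ha : 0 < a) (hr : 0 < r) (ht : t < r) :
    mgf id (gammaMeasure a r) t = (r / (r - t)) ^ a := by
  unfold mgf
  rw [integral_gammaMeasure ha hr]
  simp_rw [id, smul_eq_mul, gammaPDFReal_mul_exp hr ht]
  rw [integral_const_mul, integral_gammaPDFReal ha (sub_pos.2 ht), mul_one]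

lemma one_sub_div_mem_slitPlane {r : ℝ} (hr : 0 < r) {z : ℂ} (hz : z.re < r) :
    1 - z / r ∈ Complex.slitPlane := by
  left
  have : (1 - z / r).re = 1 - z.re / r := by
    rw [Complex.sub_re, Complex.div_ofReal_re, Complex.one_re]
  rw [this, sub_pos, div_lt_one hr]
  exact hz

/-- Identity theorem: both sides extend analytically to the half-plane `Re z < r`, where `1 - z/r`
avoids the branch cut, and they agree at real `z`. The claim is the case `z = iu`. -/
lemma charFun_gammaMeasure {a r : ℝ} (ha : 0 < a) (hr : 0 < r) (u : ℝ) :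
    charFun (gammaMeasure a r) u =
      Complex.exp (-(a * Complex.log (1 - u * Complex.I / r))) := by
  have hS : Set.Iio r ⊆ integrableExpSet id (gammaMeasure a r) := fun t ht =>
    integrable_exp_mul_gammaMeasure ha hr ht
  have hint : ∀ z : ℂ, z.re < r → z.re ∈ interior (integrableExpSet id (gammaMeasure a r)) :=
    fun z hz => interior_maximal hS isOpen_Iio hz
  let U : Set ℂ := {z | z.re < r}
  have hU : IsOpen U := isOpen_lt Complex.continuous_re continuous_const
  have hf : AnalyticOnNhd ℂ (complexMGF id (gammaMeasure a r)) U := fun z hz =>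
    analyticAt_complexMGF (hint z hz)
  have hg : AnalyticOnNhd ℂ (fun z : ℂ => Complex.exp (-(a * Complex.log (1 - z / r)))) U := by
    refine DifferentiableOn.analyticOnNhd (fun z hz => ?_) hU
    refine DifferentiableAt.differentiableWithinAt ?_
    have h1 : DifferentiableAt ℂ (fun z : ℂ => 1 - z / r) z := by fun_prop
    exact ((h1.clog (one_sub_div_mem_slitPlane hr hz)).const_mul _).neg.cexp
  have hconn : IsPreconnected U := (convex_halfSpace_re_lt r).isPreconnected
  have hreal : ∀ t : ℝ, t < r → complexMGF id (gammaMeasure a r) t =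
      Complex.exp (-(a * Complex.log (1 - t / r))) := by
    intro t ht
    have h1 : 0 < 1 - t / r := by rw [sub_pos, div_lt_one hr]; exact ht
    rw [complexMGF_ofReal, mgf_gammaMeasure ha hr ht]
    have h2 : (1 - (t : ℂ) / r) = ((1 - t / r : ℝ) : ℂ) := by push_cast; ring
    rw [h2, ← Complex.ofReal_log h1.le]
    norm_cast
    have h3 : r / (r - t) = (1 - t / r)⁻¹ := by
      have : r - t ≠ 0 := (sub_pos.2 ht).ne'
      field_simp
    rw [h3, Real.rpow_def_of_pos (inv_pos.2 h1), Real.log_inv]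
    congr 1
    ring
  -- The real points accumulate at `0`, which is all the identity theorem needs.
  have hfreq : ∃ᶠ z in 𝓝[≠] (0 : ℂ), complexMGF id (gammaMeasure a r) z =
      Complex.exp (-(a * Complex.log (1 - z / r))) := by
    have ht : Tendsto (fun t : ℝ => (t : ℂ)) (𝓝[≠] 0) (𝓝[≠] 0) := by
      refine tendsto_nhdsWithin_iff.2 ⟨?_, ?_⟩
      · exact (Complex.continuous_ofReal.tendsto' 0 0 (by simp)).mono_left nhdsWithin_le_nhds
      · filter_upwards [self_mem_nhdsWithin] with t ht
        simpa using ht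
    refine ht.frequently (Eventually.frequently ?_)
    filter_upwards [nhdsWithin_le_nhds (Iio_mem_nhds hr)] with t ht using hreal t ht
  have := hf.eqOn_of_preconnected_of_frequently_eq hg hconn (z₀ := 0) (by simpa [U] using hr) hfreq
  rw [← complexMGF_id_mul_I, this (by simpa [U] using hr)]

lemma charFun_expMeasure {r : ℝ} (hr : 0 < r) (u : ℝ) :
    charFun (expMeasure r) u = (1 - u * Complex.I / r)⁻¹ := by
  have h := one_sub_div_mem_slitPlane hr (z := u * Complex.I) (by simpa using hr)
  rw [expMeasure, charFun_gammaMeasure one_pos hr, Complex.exp_neg, Complex.ofReal_one, one_mul,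
    Complex.exp_log (Complex.slitPlane_ne_zero h)]

lemma integrable_id_gammaMeasure {a r : ℝ} (ha : 0 < a) (hr : 0 < r) :
    Integrable id (gammaMeasure a r) := by
  have := isProbabilityMeasure_gammaMeasure ha hr
  have h1 := integrable_exp_mul_gammaMeasure ha hr (t := r / 2) (by linarith)
  have h2 := integrable_exp_mul_gammaMeasure ha hr (t := -(r / 2)) (by linarith)
  refine Integrable.mono' ((h1.add h2).const_mul (2 / r)) aestronglyMeasurable_id
    (ae_of_all _ fun x => ?_)
  simp only [id, Real.norm_eq_abs, Pi.add_apply]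
  have h3 := Real.add_one_le_exp (r / 2 * x)
  have h4 := Real.add_one_le_exp (-(r / 2) * x)
  have h5 : |x| = 2 / r * (r / 2 * |x|) := by field_simp
  rw [h5]
  refine mul_le_mul_of_nonneg_left ?_ (by positivity)
  rcases abs_cases x with ⟨h, -⟩ | ⟨h, -⟩ <;> rw [h] <;>
    nlinarith [Real.exp_pos (r / 2 * x), Real.exp_pos (-(r / 2) * x)]

lemma ae_nonneg_gammaMeasure {a r : ℝ} : ∀ᵐ x ∂(gammaMeasure a r), 0 ≤ x := by
  rw [ae_iff]
  simp only [not_le]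
  change gammaMeasure a r (Set.Iio 0) = 0
  rw [gammaMeasure, withDensity_apply _ measurableSet_Iio]
  exact lintegral_gammaPDF_of_nonpos le_rfl

/-! ### Characteristic functions as means over the sample space. -/

/-- The mean `E exp(i X)`, i.e. the characteristic function of `X` at `1`. -/
noncomputable def phaseMean {Ω : Type*} [MeasurableSpace Ω] (P : Measure Ω) (X : Ω → ℝ) : ℂ :=
  ∫ ω, Complex.exp (X ω * Complex.I) ∂P

section PhaseMean

variable {Ω : Type*} [MeasurableSpace Ω] {P : Measure Ω}

lemma charFun_map_eq_phaseMean {X : Ω → ℝ} (hX : AEMeasurable X P) (t : ℝ) :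
    charFun (P.map X) t = phaseMean P (fun ω => t * X ω) := by
  rw [charFun_apply_real, integral_map hX (by fun_prop)]
  simp [phaseMean]

lemma phaseMean_congr {X Y : Ω → ℝ} (h : ∀ᵐ ω ∂P, X ω = Y ω) : phaseMean P X = phaseMean P Y :=
  integral_congr_ae (h.mono fun ω hω => by simp only [hω])

lemma iIndepFun.phaseMean_sum_range {X : ℕ → Ω → ℝ} (hX : iIndepFun X P)
    (mX : ∀ k, AEMeasurable (X k) P) (M : ℕ) :
    phaseMean P (fun ω => ∑ k ∈ Finset.range M, X k ω) =
      ∏ k ∈ Finset.range M, phaseMean P (X k) := by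
  have h := iIndepFun.integral_fun_prod_comp (𝕜 := ℂ) (X := fun i : Fin M => X i)
    (f := fun _ x => Complex.exp (x * Complex.I)) (hX.precomp Fin.val_injective)
    (fun i => mX i) (fun i => by fun_prop)
  simp only [Finset.prod_range, ← Complex.exp_sum, phaseMean] at h ⊢
  rw [← h]
  refine integral_congr_ae (ae_of_all _ fun ω => ?_)
  simp [Finset.sum_range, Finset.sum_mul]

lemma tendsto_phaseMean [IsFiniteMeasure P] {ι : Type*} {l : Filter ι} [l.IsCountablyGenerated]
    {X : ι → Ω → ℝ} {Z : Ω → ℝ} (hX : ∀ n, AEMeasurable (X n) P)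
    (h : ∀ᵐ ω ∂P, Tendsto (fun n => X n ω) l (𝓝 (Z ω))) :
    Tendsto (fun n => phaseMean P (X n)) l (𝓝 (phaseMean P Z)) := by
  refine tendsto_integral_filter_of_dominated_convergence (fun _ => 1) (Eventually.of_forall
    fun n => ?_) (Eventually.of_forall fun n => ae_of_all _ fun ω => ?_) (integrable_const _) ?_
  · have := hX n
    fun_prop
  · simp [Complex.norm_exp_ofReal_mul_I]
  · filter_upwards [h] with ω hω
    exact ((Complex.continuous_ofReal.tendsto _).comp hω |>.mul_const _).cexp

end PhaseMean

/-! ### Random sums with a Poisson number of terms. -/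

section RandomSum

lemma measurable_sum_range (n : ℕ) :
    Measurable fun e : ℕ → ℝ => ∑ k ∈ Finset.range n, e k :=
  Finset.measurable_fun_sum _ fun k _ => measurable_pi_apply k

lemma measurable_sum_range_uncurry :
    Measurable fun p : ℕ × (ℕ → ℝ) => ∑ k ∈ Finset.range p.1, p.2 k :=
  measurable_from_prod_countable_right measurable_sum_range

lemma aemeasurable_randomSum {Ω : Type*} [MeasurableSpace Ω] {P : Measure Ω} {N : Ω → ℕ}
    {E : ℕ → Ω → ℝ} (hN : AEMeasurable N P) (hE : ∀ k, AEMeasurable (E k) P) :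
    AEMeasurable (randomSum N E) P :=
  measurable_sum_range_uncurry.comp_aemeasurable (hN.prodMk (aemeasurable_pi_lambda _ hE))

variable {Ω : Type*} [MeasurableSpace Ω] {P : Measure Ω} [IsProbabilityMeasure P]
  {N : Ω → ℕ} {E : ℕ → Ω → ℝ} {r : ℝ≥0}

lemma hasLaw_prodMk_randomSum (hN : HasLaw N (poissonMeasure r) P)
    (hE : ∀ k, AEMeasurable (E k) P) (hNE : IndepFun N (fun ω k => E k ω) P) :
    HasLaw (fun ω => (N ω, fun k => E k ω))
      ((poissonMeasure r).prod (P.map fun ω k => E k ω)) P :=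
  (indepFun_iff_hasLaw_prodMk_prod hN ⟨aemeasurable_pi_lambda _ hE, rfl⟩).1 hNE

/-- Conditioning on the count: by independence the joint law of `N` and the summands is a product,
so Fubini applies and the outer Poisson mean is a series. -/
lemma hasSum_integral_randomSum {F : Type*} [NormedAddCommGroup F] [NormedSpace ℝ F]
    [CompleteSpace F]
    (hN : HasLaw N (poissonMeasure r) P) (hE : ∀ k, AEMeasurable (E k) P)
    (hNE : IndepFun N (fun ω k => E k ω) P) {g : ℝ → F} (hg : StronglyMeasurable g)
    {C : ℝ} (hC : ∀ x, ‖g x‖ ≤ C) :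
    HasSum (fun m : ℕ => (Real.exp (-r) * r ^ m / m !) •
      ∫ ω, g (∑ k ∈ Finset.range m, E k ω) ∂P) (∫ ω, g (randomSum N E ω) ∂P) := by
  have hE' : AEMeasurable (fun ω k => E k ω) P := aemeasurable_pi_lambda _ hE
  have : IsProbabilityMeasure (P.map fun ω k => E k ω) := Measure.isProbabilityMeasure_map hE'
  have hlaw := hasLaw_prodMk_randomSum hN hE hNE
  have hm : StronglyMeasurable fun p : ℕ × (ℕ → ℝ) => g (∑ k ∈ Finset.range p.1, p.2 k) :=
    hg.comp_measurable measurable_sum_range_uncurry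
  have hint : Integrable (fun p : ℕ × (ℕ → ℝ) => g (∑ k ∈ Finset.range p.1, p.2 k))
      ((poissonMeasure r).prod (P.map fun ω k => E k ω)) :=
    Integrable.of_bound hm.aestronglyMeasurable C (ae_of_all _ fun p => hC _)
  have h1 : ∫ ω, g (randomSum N E ω) ∂P =
      ∫ n, ∫ e, g (∑ k ∈ Finset.range n, e k) ∂(P.map fun ω k => E k ω) ∂(poissonMeasure r) := by
    rw [← integral_prod _ hint, ← hlaw.integral_comp hm.aestronglyMeasurable]
    rfl
  rw [h1]
  convert hasSum_integral_poissonMeasure hint.integral_prod_left using 3 with m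
  rw [integral_map hE']
  exact (hg.comp_measurable (measurable_sum_range m)).aestronglyMeasurable

/-- Given `N = m` the mean is `c ^ m`, and the Poisson weights sum this to an exponential. It serves
both for the exponential sums and for the jumps in one cell. -/
lemma phaseMean_randomSum (hN : HasLaw N (poissonMeasure r) P) (hE : ∀ k, AEMeasurable (E k) P)
    (hE_indep : iIndepFun E P) (hNE : IndepFun N (fun ω k => E k ω) P) {c : ℂ}
    (hc : ∀ k, phaseMean P (E k) = c) :
    phaseMean P (randomSum N E) = Complex.exp (r * (c - 1)) := by
  have h := hasSum_integral_randomSum hN hE hNE (g := fun x => Complex.exp (x * Complex.I))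
    (Continuous.stronglyMeasurable (by fun_prop)) (C := 1)
    (fun x => (Complex.norm_exp_ofReal_mul_I x).le)
  refine h.unique ?_
  have h2 : ∀ m : ℕ, ∫ ω, Complex.exp ((∑ k ∈ Finset.range m, E k ω : ℝ) * Complex.I) ∂P =
      c ^ m := fun m => by
    have := iIndepFun.phaseMean_sum_range hE_indep hE m
    simp only [hc, Finset.prod_const, Finset.card_range] at this
    exact this
  simp_rw [h2]
  have h3 := (NormedSpace.expSeries_div_hasSum_exp ((r : ℂ) * c)).mul_left (Complex.exp (-r))
  rw [← Complex.exp_eq_exp_ℂ, ← Complex.exp_add] at h3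
  rw [show (r : ℂ) * (c - 1) = -r + r * c by ring]
  convert! h3 using 2 with m
  rw [Complex.real_smul]
  push_cast
  rw [mul_pow]
  ring

lemma integrable_randomSum (hN : HasLaw N (poissonMeasure r) P) (hE : ∀ k, AEMeasurable (E k) P)
    (hNE : IndepFun N (fun ω k => E k ω) P) {C : ℝ≥0} (hC : ∀ k, ∫⁻ ω, ‖E k ω‖ₑ ∂P ≤ C) :
    Integrable (randomSum N E) P := by
  have hE' : AEMeasurable (fun ω k => E k ω) P := aemeasurable_pi_lambda _ hE
  have : IsProbabilityMeasure (P.map fun ω k => E k ω) := Measure.isProbabilityMeasure_map hE'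
  have hlaw := hasLaw_prodMk_randomSum hN hE hNE
  refine ⟨(aemeasurable_randomSum hN.aemeasurable hE).aestronglyMeasurable, ?_⟩
  have hm : Measurable fun p : ℕ × (ℕ → ℝ) => ‖∑ k ∈ Finset.range p.1, p.2 k‖ₑ :=
    measurable_sum_range_uncurry.enorm
  have h1 : ∫⁻ ω, ‖randomSum N E ω‖ₑ ∂P = ∫⁻ n, ∫⁻ e, ‖∑ k ∈ Finset.range n, e k‖ₑ
      ∂(P.map fun ω k => E k ω) ∂(poissonMeasure r) := by
    rw [← lintegral_prod _ hm.aemeasurable, ← hlaw.lintegral_comp hm.aemeasurable]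
    rfl
  have h2 : ∀ n : ℕ, ∫⁻ e, ‖∑ k ∈ Finset.range n, e k‖ₑ ∂(P.map fun ω k => E k ω) ≤ ‖(n : ℝ) * C‖ₑ := by
    intro n
    rw [lintegral_map' (by fun_prop) hE']
    calc ∫⁻ ω, ‖∑ k ∈ Finset.range n, E k ω‖ₑ ∂P
        ≤ ∫⁻ ω, ∑ k ∈ Finset.range n, ‖E k ω‖ₑ ∂P :=
          lintegral_mono fun ω => enorm_sum_le _ _
      _ = ∑ k ∈ Finset.range n, ∫⁻ ω, ‖E k ω‖ₑ ∂P :=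
          lintegral_finsetSum' _ fun k _ => (hE k).enorm
      _ ≤ ∑ k ∈ Finset.range n, (C : ENNReal) := Finset.sum_le_sum fun k _ => hC k
      _ = ‖(n : ℝ) * C‖ₑ := by simp [enorm_mul, Real.enorm_of_nonneg]
  have h3 : Integrable (fun n : ℕ => (n : ℝ) * C) (poissonMeasure r) := by
    refine Integrable.mul_const ?_ _
    rw [integrable_poissonMeasure_iff, ← summable_nat_add_iff 1]
    refine ((NormedSpace.expSeries_div_summable (r : ℝ)).mul_left (Real.exp (-r) * r)).congr
      fun n => ?_
    rw [Nat.factorial_succ]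
    push_cast
    rw [Real.norm_of_nonneg (by positivity)]
    field_simp
    ring
  refine (lintegral_mono h2).trans_lt h3.2 |> fun h => ?_
  rw [hasFiniteIntegral_iff_enorm, h1]
  exact h

end RandomSum

/-! ### Deterministic càdlàg paths and their integrals by parts. -/

section CadlagPath

/-- A real path that is right-continuous with left limits. -/
def IsCadlagPath (y : ℝ → ℝ) : Prop :=
  ∀ t, ContinuousWithinAt y (Set.Ici t) t ∧ ∃ l : ℝ, Tendsto y (𝓝[<] t) (𝓝 l)

/-- The pathwise integral `∫_{(0,h]} e^{-s} dy(s)`, defined by integration by parts. -/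
noncomputable def expPathIntegral (y : ℝ → ℝ) (h : ℝ) : ℝ :=
  Real.exp (-h) * y h - y 0 + ∫ s in (0 : ℝ)..h, Real.exp (-s) * y s

/-- The path `y`, sampled from the right on the grid of mesh `δ`. -/
noncomputable def gridPath (y : ℝ → ℝ) (δ s : ℝ) : ℝ := y (⌈s / δ⌉₊ * δ)

variable {y : ℝ → ℝ}

lemma IsCadlagPath.comp_const_add (hy : IsCadlagPath y) (a : ℝ) :
    IsCadlagPath fun s => y (a + s) := by
  intro t
  have hc : Continuous fun s : ℝ => a + s := by fun_prop
  refine ⟨?_, ?_⟩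
  · refine ContinuousWithinAt.comp (t := Set.Ici (a + t)) (hy (a + t)).1 hc.continuousWithinAt ?_
    intro s hs
    simpa using hs
  · obtain ⟨l, hl⟩ := (hy (a + t)).2
    refine ⟨l, hl.comp (tendsto_nhdsWithin_iff.2
      ⟨(hc.tendsto t).mono_left nhdsWithin_le_nhds, ?_⟩)⟩
    filter_upwards [self_mem_nhdsWithin] with s hs
    simpa using hs

/-- Right-continuity and the left limit bound the path near each point; compactness makes the bound
uniform. -/
lemma IsCadlagPath.exists_bound (hy : IsCadlagPath y) (a b : ℝ) :
    ∃ C, ∀ s ∈ Set.Icc a b, |y s| ≤ C := by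
  refine isCompact_Icc.induction_on (p := fun S => ∃ C, ∀ s ∈ S, |y s| ≤ C) ⟨0, by simp⟩
    (fun S T hST ⟨C, hC⟩ => ⟨C, fun s hs => hC s (hST hs)⟩) ?_ ?_
  · rintro S T ⟨C, hC⟩ ⟨D, hD⟩
    refine ⟨max C D, fun s hs => ?_⟩
    rcases hs with hs | hs
    · exact (hC s hs).trans (le_max_left _ _)
    · exact (hD s hs).trans (le_max_right _ _)
  · intro t _
    obtain ⟨hr, l, hl⟩ := hy t
    have h1 := hr.tendsto.abs.eventually_lt_const (lt_add_one _)
    have h2 := hl.abs.eventually_lt_const (lt_add_one _)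
    have h3 : ∀ᶠ s in 𝓝 t, |y s| ≤ max (|y t| + 1) (|l| + 1) := by
      rw [← nhdsLT_sup_nhdsGE, eventually_sup]
      exact ⟨h2.mono fun s hs => hs.le.trans (le_max_right _ _),
        h1.mono fun s hs => hs.le.trans (le_max_left _ _)⟩
    exact ⟨_, nhdsWithin_le_nhds h3, _, fun s hs => hs⟩

lemma measurable_gridPath (y : ℝ → ℝ) (δ : ℝ) : Measurable (gridPath y δ) := by
  have h : Measurable fun k : ℕ => y (k * δ) := measurable_from_nat
  exact h.comp (Nat.measurable_ceil.comp (measurable_id.div_const δ))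

lemma gridPath_of_mem {δ s : ℝ} (hδ : 0 < δ) {j : ℕ}
    (hs : s ∈ Set.Ioc (j * δ) ((j + 1 : ℕ) * δ)) : gridPath y δ s = y ((j + 1 : ℕ) * δ) := by
  have : ⌈s / δ⌉₊ = j + 1 := by
    rw [Nat.ceil_eq_iff (by omega)]
    exact ⟨by simpa [lt_div_iff₀ hδ] using hs.1, by simpa [div_le_iff₀ hδ] using hs.2⟩
  rw [gridPath, this]

/-- The sampling points lie in `[s, s + δ]`, so right-continuity alone suffices. -/
lemma IsCadlagPath.tendsto_gridPath (hy : IsCadlagPath y) {δ : ℕ → ℝ} (hδ : ∀ᶠ m in atTop, 0 < δ m)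
    (hδ0 : Tendsto δ atTop (𝓝 0)) {s : ℝ} (hs : 0 ≤ s) :
    Tendsto (fun m => gridPath y (δ m) s) atTop (𝓝 (y s)) := by
  refine (hy s).1.tendsto.comp (tendsto_nhdsWithin_iff.2 ⟨?_, ?_⟩)
  · have h1 : Tendsto (fun m => s + δ m) atTop (𝓝 s) := by simpa using hδ0.const_add s
    refine tendsto_of_tendsto_of_tendsto_of_le_of_le' tendsto_const_nhds h1 ?_ ?_
    · filter_upwards [hδ] with m hm
      exact (div_le_iff₀ hm).1 (Nat.le_ceil (s / δ m))
    · filter_upwards [hδ] with m hm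
      have := (Nat.ceil_lt_add_one (div_nonneg hs hm.le)).le
      calc (⌈s / δ m⌉₊ : ℝ) * δ m ≤ (s / δ m + 1) * δ m :=
            mul_le_mul_of_nonneg_right this hm.le
        _ = s + δ m := by field_simp
  · filter_upwards [hδ] with m hm
    exact (div_le_iff₀ hm).1 (Nat.le_ceil (s / δ m))

lemma abs_gridPath_le {δ : ℝ} (hδ : 0 < δ) {M : ℕ} {C : ℝ}
    (hC : ∀ s ∈ Set.Icc 0 (M * δ), |y s| ≤ C) {s : ℝ} (hs : s ≤ M * δ) :
    |gridPath y δ s| ≤ C := by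
  refine hC _ ⟨by positivity, mul_le_mul_of_nonneg_right ?_ hδ.le⟩
  rw [Nat.cast_le, Nat.ceil_le, div_le_iff₀ hδ]
  exact hs

lemma intervalIntegrable_mul_gridPath (hy : IsCadlagPath y) {f : ℝ → ℝ} (hf : Continuous f)
    {δ : ℝ} (hδ : 0 < δ) (a b : ℝ) :
    IntervalIntegrable (fun s => f s * gridPath y δ s) volume a b := by
  obtain ⟨M, hM⟩ := exists_nat_ge (max a b / δ)
  rw [div_le_iff₀ hδ] at hM
  obtain ⟨C, hC⟩ := hy.exists_bound 0 (M * δ)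
  refine IntervalIntegrable.mono_fun' (g := fun s => |f s| * C) ?_ ?_ ?_
  · exact Continuous.intervalIntegrable (by fun_prop) _ _
  · exact (hf.measurable.mul (measurable_gridPath y δ)).aestronglyMeasurable
  · refine (ae_restrict_iff' measurableSet_uIoc).2 (ae_of_all _ fun s hs => ?_)
    simp only [Real.norm_eq_abs, abs_mul]
    refine mul_le_mul_of_nonneg_left (abs_gridPath_le hδ hC ?_) (abs_nonneg _)
    exact hs.2.trans hM

lemma integral_exp_neg_eq (a b : ℝ) :
    ∫ s in a..b, Real.exp (-s) = Real.exp (-a) - Real.exp (-b) := by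
  have : ∀ s ∈ Set.uIcc a b, HasDerivAt (fun s => -Real.exp (-s)) (Real.exp (-s)) s := by
    intro s _
    simpa using! (hasDerivAt_neg s).exp.neg
  rw [intervalIntegral.integral_eq_sub_of_hasDerivAt this
    (Continuous.intervalIntegrable (by fun_prop) _ _)]
  ring

/-- Summation by parts, exact at every mesh: the Riemann–Stieltjes sum is the integration-by-parts
formula with the path under the integral replaced by its grid version, which is constant on each
half-open cell. -/
lemma sum_exp_mul_increment (hy : IsCadlagPath y) {δ : ℝ} (hδ : 0 < δ) (M : ℕ) :
    ∑ j ∈ Finset.range M, Real.exp (-(j * δ)) * (y ((j + 1 : ℕ) * δ) - y (j * δ)) =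
      Real.exp (-(M * δ)) * y (M * δ) - y 0 +
        ∫ s in (0 : ℝ)..(M * δ), Real.exp (-s) * gridPath y δ s := by
  have hii := intervalIntegrable_mul_gridPath hy (f := fun s => Real.exp (-s)) (by fun_prop) hδ
  induction M with
  | zero => simp
  | succ M ih =>
    have h1 : ∫ s in (M * δ)..((M + 1 : ℕ) * δ), Real.exp (-s) * gridPath y δ s =
        (Real.exp (-(M * δ)) - Real.exp (-((M + 1 : ℕ) * δ))) * y ((M + 1 : ℕ) * δ) := by
      have hle : (M : ℝ) * δ ≤ (M + 1 : ℕ) * δ := by push_cast; nlinarith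
      rw [← integral_exp_neg_eq, ← intervalIntegral.integral_mul_const]
      refine intervalIntegral.integral_congr_ae (ae_of_all _ fun s hs => ?_)
      rw [Set.uIoc_of_le hle] at hs
      rw [gridPath_of_mem hδ hs]
    rw [Finset.sum_range_succ, ih, ← intervalIntegral.integral_add_adjacent_intervals
      (hii 0 (M * δ)) (hii (M * δ) ((M + 1 : ℕ) * δ)), h1]
    ring

lemma IsCadlagPath.intervalIntegrable (hy : IsCadlagPath y) {h : ℝ} (hh : 0 ≤ h) :
    IntervalIntegrable y volume 0 h := by
  obtain ⟨C, hC⟩ := hy.exists_bound 0 h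
  refine IntervalIntegrable.mono_fun' (g := fun _ => C) intervalIntegrable_const ?_ ?_
  -- Measurability of the path in time: it is a pointwise limit of grid paths.
  · refine aestronglyMeasurable_of_tendsto_ae atTop (f := fun m : ℕ => gridPath y (1 / (m + 1)))
      (fun m => (measurable_gridPath _ _).aestronglyMeasurable) ?_
    refine (ae_restrict_iff' measurableSet_uIoc).2 (ae_of_all _ fun s hs => ?_)
    rw [Set.uIoc_of_le hh] at hs
    exact hy.tendsto_gridPath (Eventually.of_forall fun m => by positivity)
      tendsto_one_div_add_atTop_nhds_zero_nat hs.1.le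
  · refine (ae_restrict_iff' measurableSet_uIoc).2 (ae_of_all _ fun s hs => ?_)
    rw [Set.uIoc_of_le hh] at hs
    exact hC s ⟨hs.1.le, hs.2⟩

lemma tendsto_div_natCast_zero (h : ℝ) : Tendsto (fun m : ℕ => h / m) atTop (𝓝 0) :=
  tendsto_const_div_atTop_nhds_zero_nat h

lemma eventually_div_natCast_pos {h : ℝ} (hh : 0 < h) : ∀ᶠ m : ℕ in atTop, 0 < h / m := by
  filter_upwards [eventually_gt_atTop 0] with m hm
  positivity

lemma IsCadlagPath.tendsto_sum_expPathIntegral (hy : IsCadlagPath y) {h : ℝ} (hh : 0 < h) (N : ℕ) :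
    Tendsto (fun m : ℕ => ∑ j ∈ Finset.range (N * m),
      Real.exp (-(j * (h / m))) * (y ((j + 1 : ℕ) * (h / m)) - y (j * (h / m))))
      atTop (𝓝 (expPathIntegral y (N * h))) := by
  obtain ⟨C, hC⟩ := hy.exists_bound 0 (N * h)
  have hNh : 0 ≤ N * h := by positivity
  have hlim : Tendsto (fun m : ℕ => Real.exp (-(N * h)) * y (N * h) - y 0 +
      ∫ s in (0 : ℝ)..(N * h), Real.exp (-s) * gridPath y (h / m) s) atTop
      (𝓝 (expPathIntegral y (N * h))) := by
    refine tendsto_const_nhds.add ?_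
    refine intervalIntegral.tendsto_integral_filter_of_dominated_convergence
      (fun s => Real.exp (-s) * C) ?_ ?_ (Continuous.intervalIntegrable (by fun_prop) _ _) ?_
    · exact Eventually.of_forall fun m => Measurable.aestronglyMeasurable
        (Measurable.mul (by fun_prop) (measurable_gridPath _ _))
    · filter_upwards [eventually_gt_atTop 0, eventually_div_natCast_pos hh] with m hm hm'
      refine ae_of_all _ fun s hs => ?_
      rw [Set.uIoc_of_le hNh] at hs
      have he : ((N * m : ℕ) : ℝ) * (h / m) = N * h := by push_cast; field_simp
      rw [norm_mul, Real.norm_of_nonneg (Real.exp_pos _).le]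
      refine mul_le_mul_of_nonneg_left (abs_gridPath_le (M := N * m) hm' ?_ ?_) (Real.exp_pos _).le
      · rw [he]; exact hC
      · rw [he]; exact hs.2
    · refine ae_of_all _ fun s hs => ?_
      rw [Set.uIoc_of_le hNh] at hs
      exact (hy.tendsto_gridPath (eventually_div_natCast_pos hh) (tendsto_div_natCast_zero h)
        hs.1.le).const_mul _
  refine hlim.congr' ?_
  filter_upwards [eventually_gt_atTop 0, eventually_div_natCast_pos hh] with m hm hm'
  have he : ((N * m : ℕ) : ℝ) * (h / m) = N * h := by push_cast; field_simp
  rw [sum_exp_mul_increment hy hm', he]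

/-- On one cell, the restarted integral minus the increment is the integral of `e^{-s}` times the
path minus its value at the right endpoint, which is the grid value there; then `e^{-s} ≤ 1`. -/
lemma abs_sum_expPathIntegral_sub_le (hy : IsCadlagPath y) {h : ℝ} (hh : 0 < h) (K : ℕ) :
    |∑ k ∈ Finset.range K, expPathIntegral (fun s => y (k * h + s)) h - (y (K * h) - y 0)| ≤
      ∫ s in (0 : ℝ)..(K * h), |gridPath y h s - y s| := by
  have hii : ∀ a b : ℝ, 0 ≤ a → 0 ≤ b →
      IntervalIntegrable (fun s => gridPath y h s - y s) volume a b := fun a b ha hb => by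
    have h1 := intervalIntegrable_mul_gridPath hy (f := fun _ => 1) (by fun_prop) hh a b
    simp only [one_mul] at h1
    exact h1.sub ((hy.intervalIntegrable ha).symm.trans (hy.intervalIntegrable hb))
  induction K with
  | zero => simp
  | succ K ih =>
    have hK : (0 : ℝ) ≤ K * h := by positivity
    have hK1 : (0 : ℝ) ≤ (K + 1 : ℕ) * h := by positivity
    have hle : (K : ℝ) * h ≤ (K + 1 : ℕ) * h := by push_cast; nlinarith
    have hKh : (K : ℝ) * h + h = (K + 1 : ℕ) * h := by push_cast; ring
    have hys := (hy.comp_const_add (K * h)).intervalIntegrable hh.le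
    have h1 : expPathIntegral (fun s => y (K * h + s)) h - (y ((K + 1 : ℕ) * h) - y (K * h)) =
        ∫ s in (0 : ℝ)..h, Real.exp (-s) * (y (K * h + s) - y ((K + 1 : ℕ) * h)) := by
      have h2 : ∫ s in (0 : ℝ)..h, Real.exp (-s) * (y (K * h + s) - y ((K + 1 : ℕ) * h)) =
          (∫ s in (0 : ℝ)..h, Real.exp (-s) * y (K * h + s)) -
            (1 - Real.exp (-h)) * y ((K + 1 : ℕ) * h) := by
        simp_rw [mul_sub]
        rw [intervalIntegral.integral_sub (hys.continuousOn_mul (by fun_prop))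
          (Continuous.intervalIntegrable (by fun_prop) _ _),
          intervalIntegral.integral_mul_const, integral_exp_neg_eq]
        simp
      rw [h2, expPathIntegral, add_zero, hKh]
      ring
    have h3 : |∫ s in (0 : ℝ)..h, Real.exp (-s) * (y (K * h + s) - y ((K + 1 : ℕ) * h))| ≤
        ∫ s in (K * h)..((K + 1 : ℕ) * h), |gridPath y h s - y s| := by
      have h4 : ∫ s in (K * h)..((K + 1 : ℕ) * h), |gridPath y h s - y s| =
          ∫ s in (0 : ℝ)..h, |y (K * h + s) - y ((K + 1 : ℕ) * h)| := by
        have := intervalIntegral.integral_comp_add_left (a := 0) (b := h)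
          (fun s => |gridPath y h s - y s|) (K * h)
        rw [add_zero, hKh] at this
        rw [← this]
        refine intervalIntegral.integral_congr_ae (ae_of_all _ fun s hs => ?_)
        rw [Set.uIoc_of_le hh.le] at hs
        rw [gridPath_of_mem hh (j := K) ⟨by linarith [hs.1], by linarith [hs.2]⟩, abs_sub_comm]
      rw [h4]
      refine (intervalIntegral.abs_integral_le_integral_abs hh.le).trans
        (intervalIntegral.integral_mono_on hh.le ?_ ?_ fun s hs => ?_)
      · exact ((hys.sub intervalIntegrable_const).continuousOn_mul (by fun_prop)).abs
      · exact (hys.sub intervalIntegrable_const).abs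
      · rw [abs_mul, abs_of_pos (Real.exp_pos _)]
        exact mul_le_of_le_one_left (abs_nonneg _) (Real.exp_le_one_iff.2 (by linarith [hs.1]))
    rw [Finset.sum_range_succ, ← intervalIntegral.integral_add_adjacent_intervals
      (hii 0 _ le_rfl hK).abs (hii _ _ hK hK1).abs]
    refine le_trans ?_ (add_le_add ih h3)
    rw [← h1]
    refine le_trans (le_of_eq ?_) (abs_add_le _ _)
    congr 1
    ring

lemma IsCadlagPath.tendsto_sum_expPathIntegral_shift (hy : IsCadlagPath y) :
    Tendsto (fun n : ℕ => ∑ k ∈ Finset.range n,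
      expPathIntegral (fun s => y (k * (1 / n) + s)) (1 / n)) atTop (𝓝 (y 1 - y 0)) := by
  obtain ⟨C, hC⟩ := hy.exists_bound 0 1
  have hlim : Tendsto (fun n : ℕ => ∫ s in (0 : ℝ)..1, |gridPath y (1 / n) s - y s|) atTop
      (𝓝 (∫ s in (0 : ℝ)..1, 0)) := by
    refine intervalIntegral.tendsto_integral_filter_of_dominated_convergence
      (fun s => C + C) ?_ ?_ intervalIntegrable_const ?_
    · refine Eventually.of_forall fun m => AEStronglyMeasurable.norm (AEStronglyMeasurable.sub
        (measurable_gridPath _ _).aestronglyMeasurable ?_)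
      rw [Set.uIoc_of_le zero_le_one]
      exact ((intervalIntegrable_iff_integrableOn_Ioc_of_le zero_le_one).1
        (hy.intervalIntegrable zero_le_one)).aestronglyMeasurable
    · filter_upwards [eventually_gt_atTop 0, eventually_div_natCast_pos one_pos] with m hm hm'
      refine ae_of_all _ fun s hs => ?_
      rw [Set.uIoc_of_le zero_le_one] at hs
      have he : (m : ℝ) * (1 / m) = 1 := by field_simp
      rw [Real.norm_eq_abs, abs_abs]
      refine (abs_sub _ _).trans (add_le_add (abs_gridPath_le (M := m) hm' ?_ ?_)
        (hC s ⟨hs.1.le, hs.2⟩))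
      · rw [he]; exact hC
      · rw [he]; exact hs.2
    · refine ae_of_all _ fun s hs => ?_
      rw [Set.uIoc_of_le zero_le_one] at hs
      have := (hy.tendsto_gridPath (eventually_div_natCast_pos one_pos) (tendsto_div_natCast_zero 1)
        hs.1.le).sub_const (y s)
      simpa using this.abs
  rw [intervalIntegral.integral_zero] at hlim
  rw [← tendsto_sub_nhds_zero_iff]
  refine squeeze_zero_norm' ?_ hlim
  filter_upwards [eventually_gt_atTop 0, eventually_div_natCast_pos one_pos] with m hm hm'
  have := abs_sum_expPathIntegral_sub_le hy hm' m
  have he : (m : ℝ) * (1 / m) = 1 := by field_simp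
  rwa [he] at this

end CadlagPath

/-! ### The law of `Y(1)` is determined by the law of the random integral. -/

section LevyProcess

lemma Finset.prod_range_mul_eq {M : Type*} [CommMonoid M] (f : ℕ → M) (n m : ℕ) :
    ∏ i ∈ Finset.range (n * m), f i =
      ∏ k ∈ Finset.range n, ∏ j ∈ Finset.range m, f (k * m + j) := by
  induction n with
  | zero => simp
  | succ n ih => rw [Nat.succ_mul, Finset.prod_range_add, ih, Finset.prod_range_succ]

lemma Finset.sum_range_mul_eq {M : Type*} [AddCommMonoid M] (f : ℕ → M) (n m : ℕ) :
    ∑ i ∈ Finset.range (n * m), f i =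
      ∑ k ∈ Finset.range n, ∑ j ∈ Finset.range m, f (k * m + j) := by
  induction n with
  | zero => simp
  | succ n ih => rw [Nat.succ_mul, Finset.sum_range_add, ih, Finset.sum_range_succ]

/-- The path of a process at `ω`, extended by its initial value to negative times. -/
def realPath {Ω : Type*} (Y : ℝ≥0 → Ω → ℝ) (ω : Ω) (s : ℝ) : ℝ := Y s.toNNReal ω

lemma expRandomIntegral_eq_expPathIntegral {Ω : Type*} (Y : ℝ≥0 → Ω → ℝ)
    (T : ℝ) (ω : Ω) :
    expRandomIntegral Y T ω = expPathIntegral (realPath Y ω) T := by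
  simp [expRandomIntegral, expPathIntegral, realPath]

variable {Ω : Type*} [MeasurableSpace Ω] {P : Measure Ω} {Y : ℝ≥0 → Ω → ℝ}

lemma IsLevyProcess.ae_isCadlagPath (hY : IsLevyProcess Y P) :
    ∀ᵐ ω ∂P, IsCadlagPath (realPath Y ω) := by
  filter_upwards [hY.cadlag] with ω hω t
  obtain ⟨hr, l, hl⟩ := hω t.toNNReal
  have hc := continuous_real_toNNReal
  refine ⟨?_, ?_⟩
  · exact ContinuousWithinAt.comp (t := Set.Ici t.toNNReal) hr hc.continuousWithinAt
      fun s hs => Real.toNNReal_le_toNNReal hs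
  · rcases le_or_gt t 0 with ht | ht
    · refine ⟨Y 0 ω, tendsto_const_nhds.congr' ?_⟩
      filter_upwards [self_mem_nhdsWithin] with s hs
      rw [realPath, Real.toNNReal_of_nonpos (hs.le.trans ht)]
    · refine ⟨l, hl.comp (tendsto_nhdsWithin_iff.2
        ⟨(hc.tendsto t).mono_left nhdsWithin_le_nhds, ?_⟩)⟩
      filter_upwards [self_mem_nhdsWithin] with s hs
      exact (Real.toNNReal_lt_toNNReal_iff ht).2 hs

lemma IsLevyProcess.measurable_realPath (hY : IsLevyProcess Y P) (s : ℝ) :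
    Measurable fun ω => realPath Y ω s := hY.measurable _

lemma IsLevyProcess.phaseMean_sum_increments (hY : IsLevyProcess Y P) {δ : ℝ} (hδ : 0 ≤ δ)
    (c : ℕ → ℝ) (M : ℕ) :
    phaseMean P (fun ω => ∑ j ∈ Finset.range M,
      c j * (realPath Y ω ((j + 1 : ℕ) * δ) - realPath Y ω (j * δ))) =
      ∏ j ∈ Finset.range M, charFun (P.map (Y δ.toNNReal)) (c j) := by
  have hmono : Monotone fun j : ℕ => ((j : ℝ) * δ).toNNReal := fun i j hij =>
    Real.toNNReal_le_toNNReal (mul_le_mul_of_nonneg_right (Nat.cast_le.2 hij) hδ)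
  have hind := hY.indep_increments.nat hmono
  have hind' := hind.comp (fun j x => c j * x) (fun j => by fun_prop)
  have h := iIndepFun.phaseMean_sum_range hind' (fun j => by
    have := ((hY.measurable ((j + 1 : ℕ) * δ).toNNReal).sub
      (hY.measurable (j * δ).toNNReal)).const_mul (c j)
    exact this.aemeasurable) M
  refine h.trans (Finset.prod_congr rfl fun j _ => ?_)
  have hst := hY.stationary_increments (j * δ).toNNReal δ.toNNReal
  rw [← Real.toNNReal_add (by positivity) hδ,
    show (j : ℝ) * δ + δ = (j + 1 : ℕ) * δ by push_cast; ring] at hst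
  rw [← hst.map_eq, charFun_map_eq_phaseMean hst.aemeasurable_fst]
  rfl

lemma IsLevyProcess.aemeasurable_expPathIntegral (hY : IsLevyProcess Y P) {h : ℝ} (hh : 0 < h) :
    AEMeasurable (fun ω => expPathIntegral (realPath Y ω) h) P := by
  refine aemeasurable_of_tendsto_metrizable_ae atTop (f := fun (m : ℕ) ω =>
    ∑ j ∈ Finset.range (1 * m), Real.exp (-(j * (h / m))) *
        (realPath Y ω ((j + 1 : ℕ) * (h / m)) - realPath Y ω (j * (h / m)))) (fun m => ?_) ?_
  · have := hY.measurable_realPath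
    fun_prop
  · filter_upwards [hY.ae_isCadlagPath] with ω hω
    simpa using hω.tendsto_sum_expPathIntegral hh 1

/-- The characteristic function at `u` of the random integral `∫_{(0,h]} e^{-s} dY(s)`. -/
noncomputable def expIntegralCharFun (P : Measure Ω) (Y : ℝ≥0 → Ω → ℝ) (h u : ℝ) : ℂ :=
  phaseMean P fun ω => u * expPathIntegral (realPath Y ω) h

variable [IsProbabilityMeasure P]

/-- Finite Riemann–Stieltjes sums factorise by independent stationary increments. Comparing such
products before the limit avoids discussing the independence of the limiting integrals. -/
lemma IsLevyProcess.tendsto_expIntegralCharFun (hY : IsLevyProcess Y P) {h : ℝ} (hh : 0 < h)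
    (N : ℕ) (u : ℝ) :
    Tendsto (fun m : ℕ => ∏ j ∈ Finset.range (N * m),
      charFun (P.map (Y (h / m).toNNReal)) (u * Real.exp (-(j * (h / m))))) atTop
      (𝓝 (expIntegralCharFun P Y (N * h) u)) := by
  have h1 : ∀ m : ℕ, ∏ j ∈ Finset.range (N * m),
      charFun (P.map (Y (h / m).toNNReal)) (u * Real.exp (-(j * (h / m)))) =
      phaseMean P fun ω => u * ∑ j ∈ Finset.range (N * m), Real.exp (-(j * (h / m))) *
        (realPath Y ω ((j + 1 : ℕ) * (h / m)) - realPath Y ω (j * (h / m))) := fun m => by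
    rw [← hY.phaseMean_sum_increments (by positivity)]
    simp_rw [Finset.mul_sum, mul_assoc]
  simp_rw [h1]
  refine tendsto_phaseMean (fun m => ?_) ?_
  · have := hY.measurable_realPath
    fun_prop
  · filter_upwards [hY.ae_isCadlagPath] with ω hω
    exact (hω.tendsto_sum_expPathIntegral hh N).const_mul u

/-- The first `m` factors of the product belong to `(0,h]`; in the remaining ones the weight
`e^{-s}` contributes a common factor `e^{-h}`, absorbed into `u`. -/
lemma IsLevyProcess.expIntegralCharFun_add (hY : IsLevyProcess Y P) {h : ℝ} (hh : 0 < h)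
    (N : ℕ) (u : ℝ) :
    expIntegralCharFun P Y ((N + 1 : ℕ) * h) u =
      expIntegralCharFun P Y h u * expIntegralCharFun P Y (N * h) (Real.exp (-h) * u) := by
  have h1 := hY.tendsto_expIntegralCharFun hh 1 u
  have h2 := hY.tendsto_expIntegralCharFun hh N (Real.exp (-h) * u)
  have h3 := hY.tendsto_expIntegralCharFun hh (N + 1) u
  simp only [one_mul, Nat.cast_one] at h1
  refine tendsto_nhds_unique h3 ((h1.mul h2).congr' ?_)
  filter_upwards [eventually_gt_atTop 0] with m hm
  rw [add_comm N 1, add_mul, one_mul, Finset.prod_range_add]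
  congr 1
  refine Finset.prod_congr rfl fun j _ => ?_
  congr 1
  rw [show -(((m + j : ℕ) : ℝ) * (h / m)) = -h + -(j * (h / m)) by push_cast; field_simp; ring,
    Real.exp_add]
  ring

lemma IsLevyProcess.phaseMean_sum_expPathIntegral_shift (hY : IsLevyProcess Y P) {h : ℝ}
    (hh : 0 < h) (n : ℕ) (u : ℝ) :
    phaseMean P (fun ω => u * ∑ k ∈ Finset.range n,
      expPathIntegral (fun s => realPath Y ω (k * h + s)) h) =
      expIntegralCharFun P Y h u ^ n := by
  have h1 := (hY.tendsto_expIntegralCharFun hh 1 u).pow n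
  simp only [one_mul, Nat.cast_one] at h1
  have h2 : ∀ᶠ m : ℕ in atTop, phaseMean P (fun ω => u * ∑ k ∈ Finset.range n,
      ∑ j ∈ Finset.range m, Real.exp (-(j * (h / m))) *
        (realPath Y ω (k * h + (j + 1 : ℕ) * (h / m)) - realPath Y ω (k * h + j * (h / m)))) =
      (∏ j ∈ Finset.range m,
        charFun (P.map (Y (h / m).toNNReal)) (u * Real.exp (-(j * (h / m))))) ^ n := by
    filter_upwards [eventually_gt_atTop 0] with m hm
    -- The remainder `i % m` restarts the exponential weight at each of the `n` cells.
    have h3 := hY.phaseMean_sum_increments (δ := h / m) (by positivity)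
      (fun i => u * Real.exp (-((i % m : ℕ) * (h / m)))) (n * m)
    rw [Finset.prod_range_mul_eq] at h3
    simp_rw [Finset.sum_range_mul_eq] at h3
    have h4 : ∀ k j : ℕ, j ∈ Finset.range m → (k * m + j) % m = j := fun k j hj => by
      rw [Nat.mul_add_mod_self_right, Nat.mod_eq_of_lt (Finset.mem_range.1 hj)]
    rw [Finset.prod_congr rfl fun k _ => Finset.prod_congr rfl fun j hj => by rw [h4 k j hj],
      Finset.prod_const, Finset.card_range] at h3
    rw [← h3]
    congr 1
    funext ω
    rw [Finset.mul_sum]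
    refine Finset.sum_congr rfl fun k _ => ?_
    rw [Finset.mul_sum]
    refine Finset.sum_congr rfl fun j hj => ?_
    rw [h4 k j hj, mul_assoc]
    congr 4
    · push_cast; field_simp; ring
    · push_cast; field_simp
  refine tendsto_nhds_unique ?_ (h1.congr' (h2.mono fun m hm => hm.symm))
  refine tendsto_phaseMean (fun m => ?_) ?_
  · have := hY.measurable_realPath
    fun_prop
  · filter_upwards [hY.ae_isCadlagPath] with ω hω
    refine Tendsto.const_mul u (tendsto_finsetSum _ fun k _ => ?_)
    have := (hω.comp_const_add (k * h)).tendsto_sum_expPathIntegral hh 1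
    simpa only [one_mul, Nat.cast_one] using this

lemma IsLevyProcess.tendsto_expIntegralCharFun_pow (hY : IsLevyProcess Y P) (u : ℝ) :
    Tendsto (fun n : ℕ => expIntegralCharFun P Y (1 / n) u ^ n) atTop
      (𝓝 (charFun (P.map (Y 1)) u)) := by
  have h1 : Tendsto (fun n : ℕ => phaseMean P (fun ω => u * ∑ k ∈ Finset.range n,
      expPathIntegral (fun s => realPath Y ω (k * (1 / n) + s)) (1 / n))) atTop
      (𝓝 (phaseMean P fun ω => u * Y 1 ω)) := by
    refine tendsto_phaseMean (fun n => ?_) ?_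
    · rcases Nat.eq_zero_or_pos n with rfl | hn
      · simp
      · refine AEMeasurable.const_mul (Finset.aemeasurable_fun_sum _ fun k _ => ?_) u
        refine aemeasurable_of_tendsto_metrizable_ae atTop (f := fun (m : ℕ) ω =>
          ∑ j ∈ Finset.range (1 * m), Real.exp (-(j * ((1 / n : ℝ) / m))) *
            (realPath Y ω (k * (1 / n) + (j + 1 : ℕ) * ((1 / n : ℝ) / m)) -
              realPath Y ω (k * (1 / n) + j * ((1 / n : ℝ) / m)))) (fun m => ?_) ?_
        · have := hY.measurable_realPath
          fun_prop
        · filter_upwards [hY.ae_isCadlagPath] with ω hω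
          simpa using (hω.comp_const_add (k * (1 / n))).tendsto_sum_expPathIntegral
            (h := 1 / n) (by positivity) 1
    · filter_upwards [hY.ae_isCadlagPath, hY.start_zero] with ω hω h0
      have := hω.tendsto_sum_expPathIntegral_shift.const_mul u
      simpa [realPath, h0] using this
  rw [charFun_map_eq_phaseMean (hY.measurable 1).aemeasurable]
  refine h1.congr' ?_
  filter_upwards [eventually_gt_atTop 0] with n hn
  exact hY.phaseMean_sum_expPathIntegral_shift (by positivity) n u

lemma IsBDLP.tendsto_expIntegralCharFun {ν : Measure ℝ} (hY : IsBDLP Y P ν) {h : ℝ} (hh : 0 < h)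
    (u : ℝ) :
    Tendsto (fun N : ℕ => expIntegralCharFun P Y (N * h) u) atTop (𝓝 (charFun ν u)) := by
  obtain ⟨X, hX, hlim⟩ := hY.integral_representation
  rw [← hX.map_eq, charFun_map_eq_phaseMean hX.aemeasurable]
  refine tendsto_phaseMean (fun N => ?_) ?_
  · rcases Nat.eq_zero_or_pos N with rfl | hN
    · simp [expPathIntegral]
    · exact (hY.isLevyProcess.aemeasurable_expPathIntegral (by positivity)).const_mul u
  · filter_upwards [hlim] with ω hω
    simp_rw [← expRandomIntegral_eq_expPathIntegral]
    exact (hω.comp (tendsto_natCast_atTop_atTop.atTop_mul_const hh)).const_mul u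

/-- Selfdecomposability of `ν`, obtained from the splitting at `h` by letting the upper endpoint
tend to infinity. -/
lemma IsBDLP.charFun_eq_mul {ν : Measure ℝ} (hY : IsBDLP Y P ν) {h : ℝ} (hh : 0 < h) (u : ℝ) :
    charFun ν u = expIntegralCharFun P Y h u * charFun ν (Real.exp (-h) * u) := by
  have h1 := (hY.tendsto_expIntegralCharFun hh u).comp (tendsto_add_atTop_nat 1)
  have h2 := (hY.tendsto_expIntegralCharFun hh (Real.exp (-h) * u)).const_mul
    (expIntegralCharFun P Y h u)
  refine tendsto_nhds_unique h1 (h2.congr fun N => ?_)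
  exact (hY.isLevyProcess.expIntegralCharFun_add hh N u).symm

lemma IsBDLP.tendsto_charFun_div_pow {ν : Measure ℝ} (hY : IsBDLP Y P ν)
    (hν : ∀ u, charFun ν u ≠ 0) (u : ℝ) :
    Tendsto (fun n : ℕ => (charFun ν u / charFun ν (Real.exp (-(1 / n)) * u)) ^ n) atTop
      (𝓝 (charFun (P.map (Y 1)) u)) := by
  refine (hY.isLevyProcess.tendsto_expIntegralCharFun_pow u).congr' ?_
  filter_upwards [eventually_gt_atTop 0] with n hn
  rw [hY.charFun_eq_mul (h := 1 / n) (by positivity) u, mul_div_cancel_right₀ _ (hν _)]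

/-- Used twice: at `s = 0` to identify the law of `Y(1)`, and along `-s` as the antiderivative in
the construction. -/
lemma hasDerivAt_log_one_sub_exp {r : ℝ} (hr : 0 < r) (u s : ℝ) :
    HasDerivAt (fun s : ℝ => Complex.log (1 - (Real.exp s * u : ℝ) * Complex.I / r))
      (1 - (1 - (Real.exp s * u : ℝ) * Complex.I / r)⁻¹) s := by
  have hm := one_sub_div_mem_slitPlane hr (z := (Real.exp s * u : ℝ) * Complex.I) (by simpa using hr)
  have h1 : HasDerivAt (fun s : ℝ => (1 - (Real.exp s * u : ℝ) * Complex.I / r : ℂ))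
      (-((Real.exp s * u : ℝ) * Complex.I / r)) s := by
    have h2 := (((Real.hasDerivAt_exp s).mul_const u).ofReal_comp.mul_const Complex.I).div_const
      (r : ℂ)
    simpa using! h2.const_sub 1
  have h3 := h1.clog_real hm
  refine h3.congr_deriv ?_
  have h0 := Complex.slitPlane_ne_zero hm
  field_simp
  ring

theorem IsBDLP.charFun_gammaMeasure {α r : ℝ} (hα : 0 < α) (hr : 0 < r)
    (hY : IsBDLP Y P (gammaMeasure α r)) (u : ℝ) :
    charFun (P.map (Y 1)) u = Complex.exp (α * ((1 - u * Complex.I / r)⁻¹ - 1)) := by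
  have hne : ∀ u, charFun (gammaMeasure α r) u ≠ 0 := fun u => by
    rw [_root_.charFun_gammaMeasure hα hr]
    exact Complex.exp_ne_zero _
  refine tendsto_nhds_unique (hY.tendsto_charFun_div_pow hne u) ?_
  have hd := hasDerivAt_log_one_sub_exp hr u 0
  rw [Real.exp_zero, one_mul] at hd
  have ht : Tendsto (fun n : ℕ => -(1 / n : ℝ)) atTop (𝓝[≠] 0) := by
    refine tendsto_nhdsWithin_iff.2 ⟨by simpa using (tendsto_div_natCast_zero 1).neg, ?_⟩
    filter_upwards [eventually_gt_atTop 0] with n hn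
    simp [hn.ne']
  -- The `n`-th power of the quotient is the exponential of `-α` times the slope between `0` and
  -- `-1/n`.
  have hs := (hd.tendsto_slope.comp ht).const_mul (-(α : ℂ))
  have hs' := hs.cexp
  rw [show (-(α : ℂ)) * (1 - (1 - u * Complex.I / r)⁻¹) = α * ((1 - u * Complex.I / r)⁻¹ - 1)
    by ring] at hs'
  refine hs'.congr' ?_
  filter_upwards [eventually_gt_atTop 0] with n hn
  have hn' : (n : ℂ) ≠ 0 := by exact_mod_cast hn.ne'
  simp only [Function.comp_apply, slope_def_module, Real.exp_zero, one_mul]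
  rw [_root_.charFun_gammaMeasure hα hr, _root_.charFun_gammaMeasure hα hr, ← Complex.exp_sub,
    ← Complex.exp_nat_mul, Complex.real_smul]
  congr 1
  push_cast
  field_simp
  ring

end LevyProcess

/-! ### The Dirichlet integral, with uniform bounds. -/

section Dirichlet

lemma integral_exp_neg_mul_Ioi {t : ℝ} (ht : 0 < t) :
    ∫ s in Set.Ioi (0 : ℝ), Real.exp (-(t * s)) = 1 / t := by
  have := integral_exp_mul_Ioi (a := -t) (by linarith) 0
  simp only [mul_zero, Real.exp_zero] at this
  simp only [neg_mul] at this
  rw [this]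
  field_simp

lemma integral_sin_mul_exp_neg (s T : ℝ) :
    ∫ t in (0 : ℝ)..T, Real.sin t * Real.exp (-(t * s)) =
      (1 + s ^ 2)⁻¹ - Real.exp (-(T * s)) * (Real.cos T + s * Real.sin T) * (1 + s ^ 2)⁻¹ := by
  have h0 : 1 + s ^ 2 ≠ 0 := by positivity
  have hd : ∀ t ∈ Set.uIcc 0 T, HasDerivAt
      (fun t => -(Real.exp (-(t * s)) * (Real.cos t + s * Real.sin t) * (1 + s ^ 2)⁻¹))
      (Real.sin t * Real.exp (-(t * s))) t := by
    intro t _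
    have h1 : HasDerivAt (fun t => Real.exp (-(t * s))) (Real.exp (-(t * s)) * (-s)) t := by
      simpa using! ((hasDerivAt_id t).mul_const s).neg.exp
    have h2 := (Real.hasDerivAt_cos t).add ((Real.hasDerivAt_sin t).const_mul s)
    refine ((h1.mul h2).mul_const (1 + s ^ 2)⁻¹).neg.congr_deriv ?_
    simp only [Pi.add_apply]
    field_simp
    ring
  rw [intervalIntegral.integral_eq_sub_of_hasDerivAt hd
    (Continuous.intervalIntegrable (by fun_prop) _ _)]
  simp
  ring

lemma integrable_exp_neg_mul_Ioi {t : ℝ} (ht : 0 < t) :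
    IntegrableOn (fun s => Real.exp (-(t * s))) (Set.Ioi 0) := by
  simpa only [neg_mul] using integrableOn_exp_mul_Ioi (a := -t) (by linarith) 0

/-- Write `1/t = ∫_0^∞ e^{-ts} ds` and apply Fubini, absolutely convergent on `(0,T]` because `|sin
t|/t` is integrable there. -/
lemma integral_sinc_eq {T : ℝ} (hT : 0 ≤ T) :
    ∫ t in (0 : ℝ)..T, Real.sinc t =
      ∫ s in Set.Ioi (0 : ℝ), ((1 + s ^ 2)⁻¹ -
        Real.exp (-(T * s)) * (Real.cos T + s * Real.sin T) * (1 + s ^ 2)⁻¹) := by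
  have hm : AEStronglyMeasurable (fun p : ℝ × ℝ => Real.sin p.1 * Real.exp (-(p.1 * p.2)))
      ((volume.restrict (Set.Ioc 0 T)).prod (volume.restrict (Set.Ioi 0))) :=
    Continuous.aestronglyMeasurable (by fun_prop)
  have hint : Integrable (fun p : ℝ × ℝ => Real.sin p.1 * Real.exp (-(p.1 * p.2)))
      ((volume.restrict (Set.Ioc 0 T)).prod (volume.restrict (Set.Ioi 0))) := by
    rw [integrable_prod_iff hm]
    constructor
    · filter_upwards [ae_restrict_mem measurableSet_Ioc] with t ht
      exact (integrable_exp_neg_mul_Ioi ht.1).const_mul _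
    · have h1 : IntegrableOn (fun t => ‖Real.sinc t‖) (Set.Ioc 0 T) :=
        (intervalIntegrable_iff_integrableOn_Ioc_of_le hT).1
          (Real.continuous_sinc.norm.intervalIntegrable 0 T)
      refine h1.congr ?_
      filter_upwards [ae_restrict_mem measurableSet_Ioc] with t ht
      simp_rw [norm_mul, Real.norm_of_nonneg (Real.exp_pos _).le]
      rw [integral_const_mul, integral_exp_neg_mul_Ioi ht.1, Real.sinc_of_ne_zero ht.1.ne',
        norm_div, Real.norm_of_nonneg ht.1.le]
      ring
  have hswap := integral_integral_swap (f := fun t s => Real.sin t * Real.exp (-(t * s))) hint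
  simp_rw [← intervalIntegral.integral_of_le hT, integral_sin_mul_exp_neg] at hswap
  rw [← hswap]
  refine intervalIntegral.integral_congr_ae (ae_of_all _ fun t ht => ?_)
  rw [Set.uIoc_of_le hT] at ht
  rw [integral_const_mul, integral_exp_neg_mul_Ioi ht.1, Real.sinc_of_ne_zero ht.1.ne']
  ring

/-- The main term is the arctangent integral `π/2`; the remainder is dominated by `2e^{-Ts}`, whose
integral is `2/T`. -/
lemma abs_integral_sinc_sub_le {T : ℝ} (hT : 0 < T) :
    |(∫ t in (0 : ℝ)..T, Real.sinc t) - Real.pi / 2| ≤ 2 / T := by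
  have hbound : ∀ s ∈ Set.Ioi (0 : ℝ),
      ‖Real.exp (-(T * s)) * (Real.cos T + s * Real.sin T) * (1 + s ^ 2)⁻¹‖ ≤
        2 * Real.exp (-(T * s)) := by
    intro s hs
    have hs' : (0 : ℝ) < s := hs
    rw [norm_mul, norm_mul, Real.norm_of_nonneg (Real.exp_pos _).le,
      Real.norm_of_nonneg (r := (1 + s ^ 2)⁻¹) (by positivity), mul_assoc, mul_comm]
    refine mul_le_mul_of_nonneg_right ?_ (Real.exp_pos _).le
    rw [← div_eq_mul_inv, div_le_iff₀ (by positivity), Real.norm_eq_abs]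
    calc |Real.cos T + s * Real.sin T| ≤ |Real.cos T| + |s * Real.sin T| := abs_add_le _ _
      _ ≤ 1 + s * 1 := by
        rw [abs_mul, abs_of_pos hs']
        exact add_le_add (Real.abs_cos_le_one T)
          (mul_le_mul_of_nonneg_left (Real.abs_sin_le_one T) hs'.le)
      _ ≤ 2 * (1 + s ^ 2) := by nlinarith [sq_nonneg (s - 1)]
  have hexp := (integrable_exp_neg_mul_Ioi hT).const_mul 2
  have hint : IntegrableOn (fun s => Real.exp (-(T * s)) * (Real.cos T + s * Real.sin T) *
      (1 + s ^ 2)⁻¹) (Set.Ioi 0) := by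
    refine Integrable.mono' hexp (Measurable.aestronglyMeasurable (by fun_prop)) ?_
    filter_upwards [ae_restrict_mem measurableSet_Ioi] with s hs using hbound s hs
  rw [integral_sinc_eq hT.le, integral_sub integrable_inv_one_add_sq.integrableOn hint,
    integral_Ioi_inv_one_add_sq]
  simp only [Real.arctan_zero, sub_zero]
  rw [sub_right_comm, sub_self, zero_sub, abs_neg, ← Real.norm_eq_abs]
  refine (norm_integral_le_of_norm_le hexp ?_).trans (le_of_eq ?_)
  · filter_upwards [ae_restrict_mem measurableSet_Ioi] with s hs using hbound s hs
  · rw [integral_const_mul, integral_exp_neg_mul_Ioi hT]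
    ring

lemma tendsto_integral_sinc :
    Tendsto (fun T : ℝ => ∫ t in (0 : ℝ)..T, Real.sinc t) atTop (𝓝 (Real.pi / 2)) := by
  rw [← tendsto_sub_nhds_zero_iff]
  refine squeeze_zero_norm' ?_ (tendsto_const_nhds.div_atTop tendsto_id : Tendsto
    (fun T : ℝ => 2 / T) atTop (𝓝 0))
  filter_upwards [eventually_gt_atTop 0] with T hT using abs_integral_sinc_sub_le hT

lemma integral_sinc_neg (T : ℝ) :
    ∫ t in (0 : ℝ)..(-T), Real.sinc t = -∫ t in (0 : ℝ)..T, Real.sinc t := by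
  have := intervalIntegral.integral_comp_neg (a := 0) (b := T) Real.sinc
  simp only [Real.sinc_neg, neg_zero] at this
  rw [this, intervalIntegral.integral_symm]

/-- A bound independent of `T`, serving as the dominating constant in the inversion formula. -/
lemma abs_integral_sinc_le (T : ℝ) : |∫ t in (0 : ℝ)..T, Real.sinc t| ≤ 4 := by
  wlog hT : 0 ≤ T generalizing T
  · have := this (-T) (by linarith)
    rwa [integral_sinc_neg, abs_neg] at this
  rcases le_total T 1 with h | h
  · have := intervalIntegral.norm_integral_le_of_norm_le_const (a := 0) (b := T) (C := 1)
      (f := Real.sinc) fun t _ => Real.abs_sinc_le_one t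
    rw [Real.norm_eq_abs, sub_zero, abs_of_nonneg hT] at this
    linarith
  · have h1 := abs_integral_sinc_sub_le (T := T) (by linarith)
    have h2 : 2 / T ≤ 2 := div_le_self (by norm_num) h
    have h3 := Real.pi_lt_four
    have h4 := Real.pi_pos
    rw [abs_le] at h1 ⊢
    constructor <;> linarith

lemma tendsto_integral_sinc_mul {x : ℝ} (hx : x ≠ 0) :
    Tendsto (fun T : ℝ => ∫ t in (0 : ℝ)..(T * x), Real.sinc t) atTop
      (𝓝 (Real.pi / 2 * SignType.sign x)) := by
  rcases lt_or_gt_of_ne hx with h | h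
  · have h1 := (tendsto_integral_sinc.comp (tendsto_id.atTop_mul_const (neg_pos.2 h))).neg
    simp only [sign_neg h]
    simpa [Function.comp_def, integral_sinc_neg] using h1
  · have h1 := tendsto_integral_sinc.comp (tendsto_id.atTop_mul_const h)
    simpa [sign_pos h, Function.comp_def] using h1

end Dirichlet

/-! ### Gil-Pelaez inversion. -/

section Inversion

variable {μ : Measure ℝ} [IsProbabilityMeasure μ]

lemma im_exp_mul_charFun (a t : ℝ) :
    (Complex.exp (-(t * a : ℝ) * Complex.I) * charFun μ t).im = ∫ x, Real.sin (t * (x - a)) ∂μ := by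
  rw [charFun_apply_real, ← integral_const_mul]
  have h1 : ∀ x : ℝ, Complex.exp (-(t * a : ℝ) * Complex.I) * Complex.exp (t * x * Complex.I) =
      Complex.exp ((t * (x - a) : ℝ) * Complex.I) := fun x => by
    rw [← Complex.exp_add]
    congr 1
    push_cast
    ring
  simp_rw [h1]
  have h2 := integral_im (𝕜 := ℂ) (μ := μ)
    (f := fun x => Complex.exp ((t * (x - a) : ℝ) * Complex.I)) (Integrable.of_bound
      (Continuous.aestronglyMeasurable (by fun_prop)) 1
      (ae_of_all _ fun x => (Complex.norm_exp_ofReal_mul_I _).le))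
  simp only [RCLike.im_eq_complex_im, Complex.exp_ofReal_mul_I_im] at h2
  rw [← h2]

/-- **Gil-Pelaez inversion formula** for a probability measure with a first moment. -/
theorem gilPelaez (hμ : Integrable id μ) {a : ℝ} (ha : μ {a} = 0) :
    HasImproperIntegral
      (fun t => (Complex.exp (-(t * a : ℝ) * Complex.I) * charFun μ t).im * (1 / t))
      (Real.pi / 2 - Real.pi * μ.real (Set.Iic a)) := by
  have hm : Continuous fun p : ℝ × ℝ => (p.2 - a) * Real.sinc (p.1 * (p.2 - a)) := by
    have := Real.continuous_sinc
    fun_prop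
  have hμa : Integrable (fun x => x - a) μ := hμ.sub (integrable_const a)
  -- The first moment enters here: `|x - a|` dominates the kernel, which permits Fubini on `(0,T]`.
  have hint : ∀ T : ℝ, 0 ≤ T →
      Integrable (fun p : ℝ × ℝ => (p.2 - a) * Real.sinc (p.1 * (p.2 - a)))
        ((volume.restrict (Set.Ioc 0 T)).prod μ) := by
    intro T hT
    refine Integrable.mono' (g := fun p => |p.2 - a|) ?_ hm.aestronglyMeasurable
      (ae_of_all _ fun p => ?_)
    · exact hμa.abs.comp_snd (volume.restrict (Set.Ioc 0 T))
    · rw [norm_mul]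
      exact mul_le_of_le_one_right (abs_nonneg _) (Real.abs_sinc_le_one _)
  have heq : ∀ t : ℝ, 0 < t → ∫ x, (x - a) * Real.sinc (t * (x - a)) ∂μ =
      (Complex.exp (-(t * a : ℝ) * Complex.I) * charFun μ t).im * (1 / t) := by
    intro t ht
    rw [im_exp_mul_charFun, ← integral_mul_const]
    refine integral_congr_ae (ae_of_all _ fun x => ?_)
    rcases eq_or_ne x a with rfl | hx
    · simp
    · have := sub_ne_zero.2 hx
      simp only
      rw [Real.sinc_of_ne_zero (by positivity)]
      field_simp
  refine ⟨fun T hT => ?_, ?_⟩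
  · rw [intervalIntegrable_iff_integrableOn_Ioc_of_le hT]
    refine (hint T hT).integral_prod_left.congr ?_
    filter_upwards [ae_restrict_mem measurableSet_Ioc] with t ht using heq t ht.1
  · have h1 : ∀ T : ℝ, 0 ≤ T →
        ∫ t in (0 : ℝ)..T, (Complex.exp (-(t * a : ℝ) * Complex.I) * charFun μ t).im * (1 / t) =
        ∫ x, (∫ t in (0 : ℝ)..(T * (x - a)), Real.sinc t) ∂μ := by
      intro T hT
      have h2 : ∫ t in (0 : ℝ)..T,
          (Complex.exp (-(t * a : ℝ) * Complex.I) * charFun μ t).im * (1 / t) =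
          ∫ t in (0 : ℝ)..T, ∫ x, (x - a) * Real.sinc (t * (x - a)) ∂μ := by
        refine intervalIntegral.integral_congr_ae (ae_of_all _ fun t ht => ?_)
        rw [Set.uIoc_of_le hT] at ht
        exact (heq t ht.1).symm
      rw [h2, intervalIntegral.integral_of_le hT, integral_integral_swap
        (f := fun t x => (x - a) * Real.sinc (t * (x - a))) (hint T hT)]
      have h3 : ∀ x : ℝ, ∫ t in Set.Ioc 0 T, (x - a) * Real.sinc (t * (x - a)) =
          ∫ t in (0 : ℝ)..(T * (x - a)), Real.sinc t := fun x => by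
        rw [← intervalIntegral.integral_of_le hT, intervalIntegral.integral_const_mul,
          intervalIntegral.mul_integral_comp_mul_right, zero_mul]
      simp_rw [h3]
    have hlim : Tendsto (fun T : ℝ => ∫ x, (∫ t in (0 : ℝ)..(T * (x - a)), Real.sinc t) ∂μ) atTop
        (𝓝 (∫ x, Real.pi / 2 * SignType.sign (x - a) ∂μ)) := by
      refine tendsto_integral_filter_of_dominated_convergence
        (F := fun (T : ℝ) x => ∫ t in (0 : ℝ)..(T * (x - a)), Real.sinc t)
        (f := fun x => Real.pi / 2 * ((SignType.sign (x - a) : SignType) : ℝ)) (μ := μ) (fun _ => 4)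
        (Eventually.of_forall fun T => ?_)
        (Eventually.of_forall fun T => ae_of_all _ fun x => abs_integral_sinc_le _)
        (integrable_const _) ?_
      · have hc := intervalIntegral.continuous_primitive
          (fun b c => Real.continuous_sinc.intervalIntegrable (μ := volume) b c) 0
        exact (hc.comp (by fun_prop : Continuous fun x => T * (x - a))).aestronglyMeasurable
      · have : ∀ᵐ x ∂μ, x ≠ a := by simpa [ae_iff] using ha
        filter_upwards [this] with x hx
        exact tendsto_integral_sinc_mul (sub_ne_zero.2 hx)
    -- Away from the null point `a`, the sign of `x - a` is one minus twice the indicator of `x ≤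
    -- a`.
    have hval : ∫ x, Real.pi / 2 * SignType.sign (x - a) ∂μ =
        Real.pi / 2 - Real.pi * μ.real (Set.Iic a) := by
      have h3 : ∀ᵐ x ∂μ, Real.pi / 2 * ((SignType.sign (x - a) : SignType) : ℝ) =
          Real.pi / 2 - Real.pi * (Set.Iic a).indicator (fun _ => (1 : ℝ)) x := by
        have : ∀ᵐ x ∂μ, x ≠ a := by simpa [ae_iff] using ha
        filter_upwards [this] with x hx
        rcases lt_or_gt_of_ne hx with h | h
        · rw [sign_neg (sub_neg.2 h), Set.indicator_of_mem (Set.mem_Iic.2 h.le)]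
          simp only [SignType.coe_neg, SignType.coe_one]
          ring
        · rw [sign_pos (sub_pos.2 h), Set.indicator_of_notMem (by simpa using h)]
          simp
      rw [integral_congr_ae h3, integral_sub (integrable_const _)
        (((integrable_const _).indicator measurableSet_Iic).const_mul _), integral_const_mul,
        integral_indicator_const _ measurableSet_Iic]
      simp
    rw [← hval]
    refine hlim.congr' ?_
    filter_upwards [eventually_ge_atTop 0] with T hT using (h1 T hT).symm

end Inversion

/-! ### The distribution function of the random sum as a Bessel integral. -/

section Bessel

lemma phaseMean_eq_charFun {Ω : Type*} [MeasurableSpace Ω] {P : Measure Ω} {X : Ω → ℝ}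
    {ν : Measure ℝ} (hX : HasLaw X ν P) (t : ℝ) :
    phaseMean P (fun ω => t * X ω) = charFun ν t := by
  rw [← hX.map_eq, charFun_map_eq_phaseMean hX.aemeasurable]

lemma hasLaw_sum_exponential {Ω : Type*} [MeasurableSpace Ω] {P : Measure Ω}
    [IsProbabilityMeasure P] {E : ℕ → Ω → ℝ} {r : ℝ} (hr : 0 < r)
    (hE : ∀ k, HasLaw (E k) (expMeasure r) P) (hE_indep : iIndepFun E P) (m : ℕ) :
    HasLaw (fun ω => ∑ k ∈ Finset.range (m + 1), E k ω) (gammaMeasure (m + 1) r) P := by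
  have hm : AEMeasurable (fun ω => ∑ k ∈ Finset.range (m + 1), E k ω) P :=
    Finset.aemeasurable_fun_sum _ fun k _ => (hE k).aemeasurable
  have hpos : (0 : ℝ) < m + 1 := by positivity
  have := isProbabilityMeasure_gammaMeasure hpos hr
  refine ⟨hm, Measure.ext_of_charFun (funext fun t => ?_)⟩
  rw [charFun_map_eq_phaseMean hm, charFun_gammaMeasure hpos hr]
  have hs := one_sub_div_mem_slitPlane hr (z := t * Complex.I) (by simpa using hr)
  have h1 := iIndepFun.phaseMean_sum_range (X := fun k ω => t * E k ω)
    (hE_indep.comp (fun _ x => t * x) fun _ => by fun_prop)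
    (fun k => (hE k).aemeasurable.const_mul t) (m + 1)
  simp_rw [Finset.mul_sum]
  rw [h1]
  simp_rw [phaseMean_eq_charFun (hE _), charFun_expMeasure hr]
  rw [Finset.prod_const, Finset.card_range, Complex.exp_neg, inv_pow]
  congr 1
  rw [← Nat.cast_succ, Complex.ofReal_natCast, Complex.exp_nat_mul,
    Complex.exp_log (Complex.slitPlane_ne_zero hs)]

lemma measureReal_Iic_gammaMeasure {a r : ℝ} (ha : 0 < a) (hr : 0 < r) {x : ℝ} (hx : 0 ≤ x) :
    (gammaMeasure a r).real (Set.Iic x) =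
      ∫ s in Set.Ioc 0 x, r ^ a / Real.Gamma a * s ^ (a - 1) * Real.exp (-(r * s)) := by
  have := isProbabilityMeasure_gammaMeasure ha hr
  have hint := integrable_gammaPDFReal ha hr
  have h0 : ∫ s in Set.Iic (0 : ℝ), gammaPDFReal a r s = 0 := by
    rw [integral_Iic_eq_integral_Iio]
    refine setIntegral_eq_zero_of_forall_eq_zero fun s hs => ?_
    exact if_neg (not_le.2 hs)
  have h1 := intervalIntegral.integral_Iic_sub_Iic (μ := volume) (f := gammaPDFReal a r) (a := 0)
    (b := x) hint.integrableOn hint.integrableOn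
  rw [h0, sub_zero] at h1
  rw [← cdf_eq_real, cdf_gammaMeasure_eq_integral ha hr, h1, intervalIntegral.integral_of_le hx]
  exact setIntegral_congr_fun measurableSet_Ioc fun s hs => if_pos hs.1.le

variable {Ω : Type*} [MeasurableSpace Ω] {P : Measure Ω} [IsProbabilityMeasure P]
  {N : Ω → ℕ} {E : ℕ → Ω → ℝ} {α r : ℝ}

/-- Index `j` stands for the event `N = j + 1`, where the sum has the gamma law of shape `j + 1`;
the event `N = 0` is the subtracted atom `e^{-α}` at the origin. -/
lemma hasSum_measureReal_randomSum_le (hα : 0 < α) (hr : 0 < r)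
    (hN : HasLaw N (poissonMeasure α.toNNReal) P) (hE : ∀ k, HasLaw (E k) (expMeasure r) P)
    (hE_indep : iIndepFun E P) (hNE : IndepFun N (fun ω k => E k ω) P) {a : ℝ} (ha : 0 ≤ a) :
    HasSum (fun j : ℕ => ∫ x in Set.Ioc 0 a,
      Real.exp (-α) * ((α * r) ^ (j + 1) * x ^ j / (j ! * (1 + j)!)) * Real.exp (-(r * x)))
      (P.real {ω | randomSum N E ω ≤ a} - Real.exp (-α)) := by
  have hE' := fun k => (hE k).aemeasurable
  have hmeas : ∀ X : Ω → ℝ, AEMeasurable X P →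
      ∫ ω, (Set.Iic a).indicator (fun _ => (1 : ℝ)) (X ω) ∂P = P.real {ω | X ω ≤ a} := by
    intro X hX
    have h1 := integral_map hX (f := (Set.Iic a).indicator fun _ => (1 : ℝ))
      (stronglyMeasurable_const.indicator measurableSet_Iic).aestronglyMeasurable
    rw [← h1, integral_indicator_const _ measurableSet_Iic,
      map_measureReal_apply_of_aemeasurable hX measurableSet_Iic, smul_eq_mul, mul_one]
    rfl
  have hsum := hasSum_integral_randomSum hN hE' hNE
    (g := (Set.Iic a).indicator fun _ => (1 : ℝ))
    (stronglyMeasurable_const.indicator measurableSet_Iic) (C := 1) (fun x => by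
      unfold Set.indicator; split_ifs <;> simp)
  -- `hasSum_nat_add_iff' 1` splits off the term `m = 0`.
  rw [hmeas _ (aemeasurable_randomSum hN.aemeasurable hE'), ← hasSum_nat_add_iff' 1,
    Real.coe_toNNReal _ hα.le] at hsum
  convert! hsum using 1
  · funext j
    have hlaw := hasLaw_sum_exponential hr hE hE_indep j
    rw [hmeas _ hlaw.aemeasurable,
      hlaw.measureReal_eq (p := fun x => x ≤ a) measurableSet_Iic]
    have h2 := measureReal_Iic_gammaMeasure (a := j + 1) (by positivity) hr ha
    change _ = _ • (gammaMeasure (j + 1) r).real (Set.Iic a)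
    rw [h2, smul_eq_mul, ← integral_const_mul]
    refine integral_congr_ae (ae_of_all _ fun x => ?_)
    simp only [Real.Gamma_nat_eq_factorial, add_sub_cancel_right, Real.rpow_natCast]
    rw [← Nat.cast_succ, Real.rpow_natCast, add_comm 1 j, mul_pow]
    field_simp
  · congr 1
    simp [ha]

/-- The terms are nonnegative on `(0,a]`, so sum and integral may be exchanged. The Jacobian `w /
(2αr)` of `x = w²/(4αr)` supplies the extra factor `w/2` that makes the series `I_1`. -/
theorem measureReal_randomSum_le (hα : 0 < α) (hr : 0 < r)
    (hN : HasLaw N (poissonMeasure α.toNNReal) P) (hE : ∀ k, HasLaw (E k) (expMeasure r) P)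
    (hE_indep : iIndepFun E P) (hNE : IndepFun N (fun ω k => E k ω) P) {a : ℝ} (ha : 0 ≤ a) :
    P.real {ω | randomSum N E ω ≤ a} = Real.exp (-α) + Real.exp (-α) *
      ∫ w in (0 : ℝ)..(2 * √(α * r * a)), besselI 1 w * Real.exp (-(w ^ 2 / (4 * α))) := by
  have hsum := hasSum_measureReal_randomSum_le hα hr hN hE hE_indep hNE ha
  set f : ℕ → ℝ → ℝ := fun j x =>
    Real.exp (-α) * ((α * r) ^ (j + 1) * x ^ j / (j ! * (1 + j)!)) * Real.exp (-(r * x)) with hf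
  have hnorm : ∀ j, ∫ x in Set.Ioc 0 a, ‖f j x‖ = ∫ x in Set.Ioc 0 a, f j x := fun j =>
    setIntegral_congr_fun measurableSet_Ioc fun x hx => by
      have := hx.1
      exact Real.norm_of_nonneg (by positivity)
  have hswap := hasSum_integral_of_summable_integral_norm (F := f)
    (μ := volume.restrict (Set.Ioc 0 a)) (fun j => by
      have : Continuous (f j) := by fun_prop
      exact (this.integrableOn_Icc).mono_set Set.Ioc_subset_Icc_self)
    (by simp_rw [hnorm]; exact hsum.summable)
  have heq := hsum.unique hswap
  set W : ℝ := 2 * √(α * r * a) with hW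
  have hW0 : 0 ≤ W := by positivity
  have hW2 : W ^ 2 / (4 * (α * r)) = a := by
    rw [hW, mul_pow, Real.sq_sqrt (by positivity)]
    field_simp
    ring
  have himage : (fun w : ℝ => w ^ 2 / (4 * (α * r))) '' Set.Ioc 0 W = Set.Ioc 0 a := by
    ext x
    constructor
    · rintro ⟨w, hw, rfl⟩
      have hw0 := hw.1
      refine ⟨by positivity, ?_⟩
      rw [← hW2]
      have := hw.2
      dsimp only
      gcongr
    · rintro ⟨hx0, hxa⟩
      refine ⟨2 * √(α * r * x), ⟨by positivity, ?_⟩, ?_⟩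
      · rw [hW]
        gcongr
      · dsimp only
        rw [mul_pow, Real.sq_sqrt (by positivity)]
        field_simp
        norm_num
  have hsubst := integral_image_eq_integral_deriv_smul_of_monotoneOn (s := Set.Ioc 0 W)
    (f := fun w : ℝ => w ^ 2 / (4 * (α * r))) (f' := fun w => w / (2 * (α * r)))
    measurableSet_Ioc (fun w _ => by
      refine HasDerivAt.hasDerivWithinAt ?_
      refine ((hasDerivAt_pow 2 w).div_const (4 * (α * r))).congr_deriv ?_
      field_simp
      ring) (fun w hw v hv hwv => by
      have := hw.1
      dsimp only
      gcongr) (fun x => ∑' j, f j x)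
  rw [himage] at hsubst
  rw [eq_add_of_sub_eq' heq, hsubst, intervalIntegral.integral_of_le hW0, ← integral_const_mul]
  congr 1
  refine integral_congr_ae (ae_of_all _ fun w => ?_)
  simp only [smul_eq_mul, besselI]
  rw [← tsum_mul_left, ← tsum_mul_right, ← tsum_mul_left]
  refine tsum_congr fun j => ?_
  simp only [hf]
  have he : r * (w ^ 2 / (4 * (α * r))) = w ^ 2 / (4 * α) := by field_simp
  rw [he, div_pow, div_pow, mul_pow 4, show (4 : ℝ) = 2 ^ 2 by norm_num, ← pow_mul, ← pow_mul,
    pow_add 2 1, pow_add w 1]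
  field_simp
  ring

end Bessel

/-! ### A model of the jumps of a compound Poisson process, cell by cell. -/

section JumpMeasure

/-- The jumps of a compound Poisson process in a time interval of unit length: their number, and
the position and size of each of them. -/
abbrev JumpCell := ℕ × (ℕ → ℝ × ℝ)

instance isProbabilityMeasure_restrict_Ioc :
    IsProbabilityMeasure ((volume : Measure ℝ).restrict (Set.Ioc 0 1)) :=
  ⟨by simp⟩

/-- The law of the jumps in a unit interval of a compound Poisson process with rate `α` and jump
law `ρ`. -/
noncomputable def jumpCellMeasure (α : ℝ≥0) (ρ : Measure ℝ) : Measure JumpCell :=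
  (poissonMeasure α).prod
    (Measure.infinitePi fun _ => ((volume : Measure ℝ).restrict (Set.Ioc 0 1)).prod ρ)

/-- The law of all the jumps of a compound Poisson process. -/
noncomputable def jumpMeasure (α : ℝ≥0) (ρ : Measure ℝ) : Measure (ℕ → JumpCell) :=
  Measure.infinitePi fun _ => jumpCellMeasure α ρ

/-- The integral of `w` over the interval `(n, n + 1]` with respect to a compound Poisson process
with the given jumps. -/
noncomputable def cellIntegral (w : ℝ → ℝ) (n : ℕ) (c : JumpCell) : ℝ :=
  ∑ k ∈ Finset.range c.1, w (n + (c.2 k).1) * (c.2 k).2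

/-- The integral of `w` over `(0, M]` with respect to a compound Poisson process with the given
jumps. -/
noncomputable def jumpIntegral (w : ℝ → ℝ) (M : ℕ) (ω : ℕ → JumpCell) : ℝ :=
  ∑ n ∈ Finset.range M, cellIntegral w n (ω n)

variable {α : ℝ≥0} {ρ : Measure ℝ} [IsProbabilityMeasure ρ] {w : ℝ → ℝ}

instance : IsProbabilityMeasure (jumpCellMeasure α ρ) := by
  unfold jumpCellMeasure; infer_instance

instance : IsProbabilityMeasure (jumpMeasure α ρ) := by
  unfold jumpMeasure; infer_instance

lemma measurable_cellIntegral (hw : Measurable w) (n : ℕ) : Measurable (cellIntegral w n) := by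
  refine measurable_from_prod_countable_right fun m => ?_
  exact Finset.measurable_fun_sum (f := fun k (e : ℕ → ℝ × ℝ) => w (n + (e k).1) * (e k).2)
    (Finset.range m) fun k _ => by fun_prop

lemma measurable_jumpIntegral (hw : Measurable w) (M : ℕ) : Measurable (jumpIntegral w M) :=
  Finset.measurable_fun_sum _ fun n _ =>
    (measurable_cellIntegral hw n).comp (measurable_pi_apply n)

lemma hasLaw_fst_jumpCellMeasure : HasLaw Prod.fst (poissonMeasure α) (jumpCellMeasure α ρ) :=
  measurePreserving_fst.hasLaw

lemma hasLaw_snd_jumpCellMeasure : HasLaw Prod.snd (Measure.infinitePi fun _ : ℕ =>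
    ((volume : Measure ℝ).restrict (Set.Ioc 0 1)).prod ρ) (jumpCellMeasure α ρ) :=
  measurePreserving_snd.hasLaw

lemma hasLaw_jump (k : ℕ) : HasLaw (fun c : JumpCell => c.2 k)
    (((volume : Measure ℝ).restrict (Set.Ioc 0 1)).prod ρ) (jumpCellMeasure α ρ) :=
  (measurePreserving_eval_infinitePi _ k).hasLaw.comp hasLaw_snd_jumpCellMeasure

lemma hasLaw_eval_jumpMeasure (n : ℕ) :
    HasLaw (fun ω => ω n) (jumpCellMeasure α ρ) (jumpMeasure α ρ) :=
  (measurePreserving_eval_infinitePi (fun _ => jumpCellMeasure α ρ) n).hasLaw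

lemma iIndepFun_jump : iIndepFun (fun (k : ℕ) (c : JumpCell) => c.2 k) (jumpCellMeasure α ρ) :=
  (iIndepFun_iff_hasLaw_Pi_infinitePi (fun k => hasLaw_jump k)
    (by fun_prop)).2 hasLaw_snd_jumpCellMeasure

lemma indepFun_fst_jump {g : ℝ × ℝ → ℝ} (hg : Measurable g) :
    IndepFun Prod.fst (fun (c : JumpCell) k => g (c.2 k)) (jumpCellMeasure α ρ) :=
  indepFun_prod (X := fun n : ℕ => n) (Y := fun (e : ℕ → ℝ × ℝ) k => g (e k)) measurable_id
    (by fun_prop)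

lemma measurable_charFun_comp (hw : Measurable w) : Measurable fun s => charFun ρ (w s) :=
  measurable_charFun.comp hw

lemma intervalIntegrable_charFun_comp (hw : Measurable w) (a b : ℝ) :
    IntervalIntegrable (fun s => charFun ρ (w s)) volume a b :=
  (intervalIntegrable_const (c := (1 : ℝ))).mono_fun'
    (measurable_charFun_comp hw).aestronglyMeasurable
    (ae_of_all _ fun _ => norm_charFun_le_one _)

/-- The position is uniform in the cell and independent of the size, so averaging over the size
gives `charFun ρ (w s)` and over the position its integral. -/
lemma phaseMean_jump (hw : Measurable w) (n k : ℕ) :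
    phaseMean (jumpCellMeasure α ρ) (fun c => w (n + (c.2 k).1) * (c.2 k).2) =
      ∫ s in (n : ℝ)..(n + 1 : ℕ), charFun ρ (w s) := by
  have hm : Measurable fun p : ℝ × ℝ => Complex.exp ((w (n + p.1) * p.2 : ℝ) * Complex.I) := by
    fun_prop
  have h1 := (hasLaw_jump (α := α) (ρ := ρ) k).integral_comp hm.aestronglyMeasurable
  have h2 : phaseMean (jumpCellMeasure α ρ) (fun c => w (n + (c.2 k).1) * (c.2 k).2) =
      ∫ p, Complex.exp ((w (n + p.1) * p.2 : ℝ) * Complex.I)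
        ∂(((volume : Measure ℝ).restrict (Set.Ioc 0 1)).prod ρ) := h1
  rw [h2, integral_prod _ (Integrable.of_bound hm.aestronglyMeasurable 1
    (ae_of_all _ fun p => (Complex.norm_exp_ofReal_mul_I _).le)),
    ← intervalIntegral.integral_of_le zero_le_one]
  have h3 := intervalIntegral.integral_comp_add_left (a := 0) (b := 1)
    (fun s => charFun ρ (w s)) (n : ℝ)
  rw [add_zero] at h3
  push_cast
  rw [← h3]
  simp_rw [charFun_apply_real]

lemma phaseMean_cellIntegral (hw : Measurable w) (n : ℕ) :
    phaseMean (jumpCellMeasure α ρ) (cellIntegral w n) =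
      Complex.exp (α * ∫ s in (n : ℝ)..(n + 1 : ℕ), (charFun ρ (w s) - 1)) := by
  have hg : Measurable fun p : ℝ × ℝ => w (n + p.1) * p.2 := by fun_prop
  have h := phaseMean_randomSum (P := jumpCellMeasure α ρ) (N := Prod.fst)
    (E := fun k c => w (n + (c.2 k).1) * (c.2 k).2) (r := α) hasLaw_fst_jumpCellMeasure
    (fun k => Measurable.aemeasurable (by fun_prop))
    (iIndepFun_jump.comp (fun _ p => w (n + p.1) * p.2) fun _ => hg)
    (indepFun_fst_jump hg) (phaseMean_jump hw n)
  rw [intervalIntegral.integral_sub (intervalIntegrable_charFun_comp hw _ _)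
    intervalIntegrable_const]
  simpa using! h

/-- Campbell's formula: cells are independent and their exponents add. Every law needed below is an
instance for a suitable `w`. -/
lemma phaseMean_jumpIntegral (hw : Measurable w) (M : ℕ) :
    phaseMean (jumpMeasure α ρ) (jumpIntegral w M) =
      Complex.exp (α * ∫ s in (0 : ℝ)..M, (charFun ρ (w s) - 1)) := by
  have hc := measurable_cellIntegral hw
  have h := iIndepFun.phaseMean_sum_range (P := jumpMeasure α ρ)
    (X := fun n ω => cellIntegral w n (ω n))
    (iIndepFun_infinitePi (P := fun _ => jumpCellMeasure α ρ) (X := fun n => cellIntegral w n) hc)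
    (fun n => ((hc n).comp (measurable_pi_apply n)).aemeasurable) M
  have h1 : ∀ n, phaseMean (jumpMeasure α ρ) (fun ω => cellIntegral w n (ω n)) =
      phaseMean (jumpCellMeasure α ρ) (cellIntegral w n) := fun n =>
    (hasLaw_eval_jumpMeasure (α := α) (ρ := ρ) n).integral_comp
      (f := fun c => Complex.exp (cellIntegral w n c * Complex.I))
      (by have := hc n; fun_prop)
  simp_rw [h1, phaseMean_cellIntegral hw] at h
  refine h.trans ?_
  rw [← Complex.exp_sum, ← Finset.mul_sum]
  have := intervalIntegral.sum_integral_adjacent_intervals (μ := volume)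
    (f := fun s => charFun ρ (w s) - 1) (a := fun n => (n : ℝ)) (n := M)
    (fun k _ => (intervalIntegrable_charFun_comp hw _ _).sub intervalIntegrable_const)
  rw [this, Nat.cast_zero]

lemma jumpIntegral_const_mul (a : ℝ) (w : ℝ → ℝ) (M : ℕ) (ω : ℕ → JumpCell) :
    jumpIntegral (fun s => a * w s) M ω = a * jumpIntegral w M ω := by
  simp only [jumpIntegral, cellIntegral, Finset.mul_sum, mul_assoc]

lemma jumpIntegral_sub (v w : ℝ → ℝ) (M : ℕ) (ω : ℕ → JumpCell) :
    jumpIntegral (fun s => v s - w s) M ω = jumpIntegral v M ω - jumpIntegral w M ω := by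
  simp only [jumpIntegral, cellIntegral, sub_mul, Finset.sum_sub_distrib]

lemma jumpIntegral_sum {ι : Type*} (S : Finset ι) (w : ι → ℝ → ℝ) (M : ℕ) (ω : ℕ → JumpCell) :
    jumpIntegral (fun s => ∑ i ∈ S, w i s) M ω = ∑ i ∈ S, jumpIntegral (w i) M ω := by
  simp only [jumpIntegral, cellIntegral, Finset.sum_mul]
  rw [Finset.sum_comm]
  exact Finset.sum_congr rfl fun n _ => Finset.sum_comm

/-- All jumps of the `n`-th cell have relative positions in `(0, 1]`. -/
def JumpsInCells (ω : ℕ → JumpCell) : Prop := ∀ n k, ((ω n).2 k).1 ∈ Set.Ioc (0 : ℝ) 1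

lemma ae_jumpsInCells : ∀ᵐ ω ∂(jumpMeasure α ρ), JumpsInCells ω := by
  refine ae_all_iff.2 fun n => ae_all_iff.2 fun k => ?_
  have h1 := (measurePreserving_fst (μ := (volume : Measure ℝ).restrict (Set.Ioc 0 1))
    (ν := ρ)).hasLaw.comp ((hasLaw_jump (α := α) (ρ := ρ) k).comp (hasLaw_eval_jumpMeasure n))
  exact (h1.ae_iff (p := fun u => u ∈ Set.Ioc (0 : ℝ) 1)
    (measurableSet_setOfPred.1 measurableSet_Ioc)).2 (ae_restrict_mem measurableSet_Ioc)

lemma ae_jump_nonneg (hρ : ∀ᵐ x ∂ρ, 0 ≤ x) :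
    ∀ᵐ ω ∂(jumpMeasure α ρ), ∀ n k, 0 ≤ ((ω n).2 k).2 := by
  refine ae_all_iff.2 fun n => ae_all_iff.2 fun k => ?_
  have h1 := (measurePreserving_snd (μ := (volume : Measure ℝ).restrict (Set.Ioc 0 1))
    (ν := ρ)).hasLaw.comp ((hasLaw_jump (α := α) (ρ := ρ) k).comp (hasLaw_eval_jumpMeasure n))
  exact (h1.ae_iff (p := fun u => 0 ≤ u) (measurableSet_setOfPred.1 measurableSet_Ici)).2 hρ

/-- Relative positions are strictly positive, so the jumps of cell `n` lie strictly beyond `n`, and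
cells from `M` on see only zeros of `w`. -/
lemma jumpIntegral_eq_of_le {ω : ℕ → JumpCell} (hω : JumpsInCells ω) {M M' : ℕ} (hM : M ≤ M')
    (hw : ∀ s : ℝ, M < s → w s = 0) : jumpIntegral w M' ω = jumpIntegral w M ω := by
  refine Finset.eventually_constant_sum (fun n hn => ?_) hM
  refine Finset.sum_eq_zero fun k _ => ?_
  rw [hw, zero_mul]
  have h1 := (hω n k).1
  have h2 : (M : ℝ) ≤ n := Nat.cast_le.2 hn
  linarith

lemma jumpIntegral_congr {ω : ℕ → JumpCell} (hω : JumpsInCells ω) {v w : ℝ → ℝ} {M : ℕ}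
    (hvw : ∀ s : ℝ, 0 < s → s ≤ M → v s = w s) : jumpIntegral v M ω = jumpIntegral w M ω := by
  refine Finset.sum_congr rfl fun n hn => Finset.sum_congr rfl fun k _ => ?_
  rw [hvw _ (add_pos_of_nonneg_of_pos n.cast_nonneg (hω n k).1)]
  have h1 := (hω n k).2
  have h2 : ((n + 1 : ℕ) : ℝ) ≤ M := Nat.cast_le.2 (Finset.mem_range.1 hn)
  push_cast at h2
  linarith

lemma integrable_cellIntegral (hρ : Integrable id ρ) (hw : Measurable w) (hw1 : ∀ s, |w s| ≤ 1)
    (n : ℕ) : Integrable (cellIntegral w n) (jumpCellMeasure α ρ) := by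
  have hg : Measurable fun p : ℝ × ℝ => w (n + p.1) * p.2 := by fun_prop
  refine integrable_randomSum (P := jumpCellMeasure α ρ) (N := Prod.fst)
    (E := fun k c => w (n + (c.2 k).1) * (c.2 k).2) (r := α) hasLaw_fst_jumpCellMeasure
    (fun k => Measurable.aemeasurable (by fun_prop)) (indepFun_fst_jump hg)
    (C := (∫⁻ x, ‖id x‖ₑ ∂ρ).toNNReal) (fun k => ?_)
  have h1 := (measurePreserving_snd (μ := (volume : Measure ℝ).restrict (Set.Ioc 0 1))
    (ν := ρ)).hasLaw.comp (hasLaw_jump (α := α) (ρ := ρ) k)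
  rw [ENNReal.coe_toNNReal hρ.2.ne, ← h1.lintegral_comp
    (f := fun x => ‖id x‖ₑ) measurable_id.enorm.aemeasurable]
  refine lintegral_mono fun c => ?_
  rw [enorm_mul]
  refine mul_le_of_le_one_left zero_le ?_
  rw [← ofReal_norm]
  exact ENNReal.ofReal_le_one.2 (hw1 _)

end JumpMeasure

/-! ### The compound Poisson process is a Lévy process. -/

section CompoundPoissonProcess

/-- The compound Poisson process with the given jumps. -/
noncomputable def jumpProcess (t : ℝ≥0) (ω : ℕ → JumpCell) : ℝ :=
  jumpIntegral ((Set.Iic (t : ℝ)).indicator fun _ => 1) ⌈t⌉₊ ω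

lemma measurable_indicator_one {S : Set ℝ} (hS : MeasurableSet S) :
    Measurable (S.indicator fun _ => (1 : ℝ)) := measurable_const.indicator hS

lemma measurable_jumpProcess (t : ℝ≥0) : Measurable (jumpProcess t) :=
  measurable_jumpIntegral (measurable_indicator_one measurableSet_Iic) _

lemma jumpProcess_zero (ω : ℕ → JumpCell) : jumpProcess 0 ω = 0 := by
  simp [jumpProcess, jumpIntegral]

lemma jumpProcess_eq {ω : ℕ → JumpCell} (hω : JumpsInCells ω) {t : ℝ≥0} {M : ℕ} (ht : t ≤ M) :
    jumpProcess t ω = jumpIntegral ((Set.Iic (t : ℝ)).indicator fun _ => 1) M ω := by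
  refine (jumpIntegral_eq_of_le hω (Nat.ceil_le.2 ht) fun s hs => ?_).symm
  refine Set.indicator_of_notMem (fun hs' => ?_) _
  have h1 : (t : ℝ) ≤ ⌈t⌉₊ := by exact_mod_cast Nat.le_ceil t
  exact absurd (Set.mem_Iic.1 hs') (by linarith)

lemma jumpProcess_sub {ω : ℕ → JumpCell} (hω : JumpsInCells ω) {s t : ℝ≥0} (hst : s ≤ t) {M : ℕ}
    (ht : t ≤ M) : jumpProcess t ω - jumpProcess s ω =
      jumpIntegral ((Set.Ioc (s : ℝ) t).indicator fun _ => 1) M ω := by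
  rw [jumpProcess_eq hω ht, jumpProcess_eq hω (hst.trans ht), ← jumpIntegral_sub]
  congr 1
  funext x
  have hst' : (s : ℝ) ≤ t := hst
  by_cases h1 : x ≤ s
  · simp [Set.indicator, h1, h1.trans hst']
  · by_cases h2 : x ≤ t <;> simp [Set.indicator, h1, h2, not_le.1 h1]

variable {α : ℝ≥0} {ρ : Measure ℝ} [IsProbabilityMeasure ρ]

lemma charFun_mul_indicator_sub_one (c : ℝ) (S : Set ℝ) (x : ℝ) :
    charFun ρ (c * S.indicator (fun _ => 1) x) - 1 =
      S.indicator (fun _ => charFun ρ c - 1) x := by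
  by_cases hx : x ∈ S <;> simp [hx]

/-- At most one indicator is nonzero at `x`, and `charFun ρ 0 - 1 = 0`; this makes exponents
additive over disjoint intervals, hence increments independent. -/
lemma charFun_sum_indicator_sub_one {n : ℕ} (S : Fin n → Set ℝ)
    (hS : Pairwise fun i j => Disjoint (S i) (S j)) (c : Fin n → ℝ) (x : ℝ) :
    charFun ρ (∑ i, c i * (S i).indicator (fun _ => 1) x) - 1 =
      ∑ i, (charFun ρ (c i * (S i).indicator (fun _ => 1) x) - 1) := by
  by_cases hx : ∃ i, x ∈ S i
  · obtain ⟨i, hi⟩ := hx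
    have h0 : ∀ j, j ≠ i → (S j).indicator (fun _ => (1 : ℝ)) x = 0 := fun j hj =>
      Set.indicator_of_notMem (fun h => Set.disjoint_left.1 (hS hj) h hi) _
    rw [Finset.sum_eq_single i (fun j _ hj => by rw [h0 j hj, mul_zero]) (by simp),
      Finset.sum_eq_single i (fun j _ hj => by simp [h0 j hj]) (by simp)]
  · push Not at hx
    simp [hx]

lemma phaseMean_sum_jumpProcess {n : ℕ} {t : Fin (n + 1) → ℝ≥0} (ht : Monotone t)
    (c : Fin n → ℝ) :
    phaseMean (jumpMeasure α ρ)
      (fun ω => ∑ i, c i * (jumpProcess (t i.succ) ω - jumpProcess (t i.castSucc) ω)) =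
      ∏ i, phaseMean (jumpMeasure α ρ)
        (fun ω => c i * (jumpProcess (t i.succ) ω - jumpProcess (t i.castSucc) ω)) := by
  obtain ⟨M, hM⟩ := exists_nat_ge (t (Fin.last n))
  set S : Fin n → Set ℝ := fun i => Set.Ioc (t i.castSucc : ℝ) (t i.succ) with hSdef
  have hmS : ∀ i, Measurable fun s => c i * (S i).indicator (fun _ => 1) s := fun i =>
    (measurable_indicator_one measurableSet_Ioc).const_mul (c i)
  have hS : Pairwise fun i j => Disjoint (S i) (S j) := by
    have hlt : ∀ i j : Fin n, i < j → Disjoint (S i) (S j) := fun i j hij => by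
      rw [Set.disjoint_left]
      intro x hx hx'
      have h1 : (t i.succ : ℝ) ≤ t j.castSucc := ht (by
        rw [Fin.le_def]; simpa using hij)
      exact absurd hx'.1 (not_lt.2 (hx.2.trans h1))
    intro i j hij
    rcases lt_or_gt_of_ne hij with h | h
    · exact hlt i j h
    · exact (hlt j i h).symm
  have hterm : ∀ ω, JumpsInCells ω → ∀ i,
      c i * (jumpProcess (t i.succ) ω - jumpProcess (t i.castSucc) ω) =
        jumpIntegral (fun s => c i * (S i).indicator (fun _ => 1) s) M ω := fun ω hω i => by
    rw [jumpIntegral_const_mul, jumpProcess_sub hω (ht i.castSucc_le_succ)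
      ((ht (Fin.le_last _)).trans hM)]
  have h1 : phaseMean (jumpMeasure α ρ)
      (fun ω => ∑ i, c i * (jumpProcess (t i.succ) ω - jumpProcess (t i.castSucc) ω)) =
      phaseMean (jumpMeasure α ρ)
        (jumpIntegral (fun s => ∑ i, c i * (S i).indicator (fun _ => 1) s) M) := by
    refine phaseMean_congr ?_
    filter_upwards [ae_jumpsInCells] with ω hω
    rw [jumpIntegral_sum]
    exact Finset.sum_congr rfl fun i _ => hterm ω hω i
  have h2 : ∀ i, phaseMean (jumpMeasure α ρ)
      (fun ω => c i * (jumpProcess (t i.succ) ω - jumpProcess (t i.castSucc) ω)) =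
      phaseMean (jumpMeasure α ρ)
        (jumpIntegral (fun s => c i * (S i).indicator (fun _ => 1) s) M) := fun i => by
    refine phaseMean_congr ?_
    filter_upwards [ae_jumpsInCells] with ω hω using hterm ω hω i
  simp_rw [h1, h2, phaseMean_jumpIntegral (hmS _)]
  rw [phaseMean_jumpIntegral (Finset.measurable_fun_sum _ fun i _ => hmS i), ← Complex.exp_sum,
    ← Finset.mul_sum, ← intervalIntegral.integral_finsetSum fun i _ =>
      (intervalIntegrable_charFun_comp (hmS i) _ _).sub intervalIntegrable_const]
  simp_rw [charFun_sum_indicator_sub_one S hS c]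

lemma phaseMean_jumpProcess_sub {s t : ℝ≥0} (hst : s ≤ t) (c : ℝ) :
    phaseMean (jumpMeasure α ρ) (fun ω => c * (jumpProcess t ω - jumpProcess s ω)) =
      Complex.exp (α * ((t - s : ℝ) * (charFun ρ c - 1))) := by
  obtain ⟨M, hM⟩ := exists_nat_ge t
  have h1 : phaseMean (jumpMeasure α ρ) (fun ω => c * (jumpProcess t ω - jumpProcess s ω)) =
      phaseMean (jumpMeasure α ρ)
        (jumpIntegral (fun x => c * (Set.Ioc (s : ℝ) t).indicator (fun _ => 1) x) M) := by
    refine phaseMean_congr ?_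
    filter_upwards [ae_jumpsInCells] with ω hω
    rw [jumpIntegral_const_mul, jumpProcess_sub hω hst hM]
  have hst' : (s : ℝ) ≤ t := hst
  have hM' : (t : ℝ) ≤ M := by exact_mod_cast hM
  rw [h1, phaseMean_jumpIntegral ((measurable_indicator_one measurableSet_Ioc).const_mul c)]
  simp_rw [charFun_mul_indicator_sub_one]
  rw [intervalIntegral.integral_of_le M.cast_nonneg, setIntegral_indicator measurableSet_Ioc,
    Set.inter_eq_right.2 (Set.Ioc_subset_Ioc s.coe_nonneg hM'), setIntegral_const]
  simp [Measure.real, ENNReal.toReal_ofReal (sub_nonneg.2 hst')]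

lemma charFun_jumpProcess_sub {s t : ℝ≥0} (hst : s ≤ t) (c : ℝ) :
    charFun ((jumpMeasure α ρ).map fun ω => jumpProcess t ω - jumpProcess s ω) c =
      Complex.exp (α * ((t - s : ℝ) * (charFun ρ c - 1))) := by
  have hm := ((measurable_jumpProcess t).sub (measurable_jumpProcess s)).aemeasurable
    (μ := jumpMeasure α ρ)
  exact (charFun_map_eq_phaseMean hm c).trans (phaseMean_jumpProcess_sub hst c)

lemma charFun_jumpProcess (t : ℝ≥0) (c : ℝ) :
    charFun ((jumpMeasure α ρ).map (jumpProcess t)) c =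
      Complex.exp (α * (t * (charFun ρ c - 1))) := by
  have := charFun_jumpProcess_sub (α := α) (ρ := ρ) (zero_le (a := t)) c
  simpa [jumpProcess_zero] using this

/-- Independence is read off from the factorisation of the joint characteristic function. -/
lemma hasIndepIncrements_jumpProcess : HasIndepIncrements jumpProcess (jumpMeasure α ρ) := by
  intro n t ht
  have hm : ∀ i : Fin n, AEMeasurable
      (fun ω => jumpProcess (t i.succ) ω - jumpProcess (t i.castSucc) ω) (jumpMeasure α ρ) :=
    fun i => ((measurable_jumpProcess _).sub (measurable_jumpProcess _)).aemeasurable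
  rw [iIndepFun_iff_charFun_pi hm]
  intro c
  simp_rw [fun i => charFun_map_eq_phaseMean (hm i)]
  rw [← phaseMean_sum_jumpProcess ht, charFun_apply, integral_map (by fun_prop) (by fun_prop)]
  refine integral_congr_ae (ae_of_all _ fun ω => ?_)
  simp [PiLp.inner_apply]

/-- Right-continuity and existence of a left limit at a point. -/
def IsCadlagAt (f : ℝ≥0 → ℝ) (t : ℝ≥0) : Prop :=
  ContinuousWithinAt f (Set.Ici t) t ∧ ∃ l : ℝ, Tendsto f (𝓝[<] t) (𝓝 l)

lemma IsCadlagAt.sum {ι : Type*} {S : Finset ι} {f : ι → ℝ≥0 → ℝ} {t : ℝ≥0}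
    (hf : ∀ i ∈ S, IsCadlagAt (f i) t) : IsCadlagAt (fun s => ∑ i ∈ S, f i s) t := by
  refine ⟨tendsto_finsetSum _ fun i hi => (hf i hi).1, ?_⟩
  choose! l hl using fun i hi => (hf i hi).2
  exact ⟨∑ i ∈ S, l i, tendsto_finsetSum _ hl⟩

lemma IsCadlagAt.mul_const {f : ℝ≥0 → ℝ} {t : ℝ≥0} (hf : IsCadlagAt f t) (a : ℝ) :
    IsCadlagAt (fun s => f s * a) t :=
  ⟨hf.1.mul_const a, hf.2.imp' (· * a) fun _ hl => hl.mul_const a⟩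

lemma IsCadlagAt.congr {f g : ℝ≥0 → ℝ} {t : ℝ≥0} (hf : IsCadlagAt f t) (h : f =ᶠ[𝓝 t] g) :
    IsCadlagAt g t := by
  refine ⟨hf.1.congr_of_eventuallyEq (h.symm.filter_mono nhdsWithin_le_nhds) h.eq_of_nhds.symm, ?_⟩
  exact hf.2.imp fun l hl => hl.congr' (h.filter_mono nhdsWithin_le_nhds)

lemma isCadlagAt_indicator_Iic (x : ℝ) (t : ℝ≥0) :
    IsCadlagAt (fun s => (Set.Iic (s : ℝ)).indicator (fun _ => (1 : ℝ)) x) t := by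
  constructor
  · rcases le_or_gt x t with h | h
    · refine tendsto_const_nhds.congr' ?_
      filter_upwards [self_mem_nhdsWithin] with s hs
      have h1 : (t : ℝ) ≤ s := hs
      simp [Set.indicator, h, h.trans h1]
    · refine tendsto_const_nhds.congr' ?_
      filter_upwards [nhdsWithin_le_nhds (NNReal.continuous_coe.continuousAt.eventually_lt
        continuousAt_const h)] with s hs
      simp [Set.indicator, not_le.2 h, not_le.2 hs]
  · rcases lt_or_ge x t with h | h
    · refine ⟨1, tendsto_const_nhds.congr' ?_⟩
      filter_upwards [nhdsWithin_le_nhds (continuousAt_const.eventually_lt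
        NNReal.continuous_coe.continuousAt h)] with s hs
      simp [Set.indicator, hs.le]
    · refine ⟨0, tendsto_const_nhds.congr' ?_⟩
      filter_upwards [self_mem_nhdsWithin] with s hs
      have h1 : (s : ℝ) < t := hs
      simp [Set.indicator, not_le.2 (h1.trans_le h)]

lemma isCadlagAt_jumpProcess {ω : ℕ → JumpCell} (hω : JumpsInCells ω) (t : ℝ≥0) :
    IsCadlagAt (fun s => jumpProcess s ω) t := by
  -- With the number of cells frozen near `t`, the path is a finite sum of step functions.
  have h1 : IsCadlagAt (fun s : ℝ≥0 =>
      jumpIntegral ((Set.Iic (s : ℝ)).indicator fun _ => 1) (⌈t⌉₊ + 1) ω) t :=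
    IsCadlagAt.sum fun n _ => IsCadlagAt.sum fun k _ =>
      (isCadlagAt_indicator_Iic _ t).mul_const _
  refine h1.congr ?_
  have h2 : t < (⌈t⌉₊ + 1 : ℕ) := by
    push_cast
    exact (Nat.le_ceil t).trans_lt (lt_add_one _)
  filter_upwards [Iio_mem_nhds h2] with s hs
  exact (jumpProcess_eq hω (le_of_lt hs)).symm

theorem isLevyProcess_jumpProcess : IsLevyProcess jumpProcess (jumpMeasure α ρ) where
  measurable := measurable_jumpProcess
  start_zero := ae_of_all _ jumpProcess_zero
  indep_increments := hasIndepIncrements_jumpProcess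
  stationary_increments s t := by
    have hm := ((measurable_jumpProcess (s + t)).sub (measurable_jumpProcess s)).aemeasurable
      (μ := jumpMeasure α ρ)
    refine ⟨hm, (measurable_jumpProcess t).aemeasurable, ?_⟩
    have := Measure.isProbabilityMeasure_map hm
    have := Measure.isProbabilityMeasure_map (μ := jumpMeasure α ρ)
      (measurable_jumpProcess t).aemeasurable
    refine Measure.ext_of_charFun (funext fun c => ?_)
    rw [charFun_jumpProcess]
    have := charFun_jumpProcess_sub (α := α) (ρ := ρ) (le_self_add (a := s) (b := t)) c
    refine this.trans ?_
    push_cast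
    ring_nf
  cadlag := by
    filter_upwards [ae_jumpsInCells] with ω hω t using isCadlagAt_jumpProcess hω t

lemma integrable_jumpProcess_one (hρ : Integrable id ρ) :
    Integrable (jumpProcess 1) (jumpMeasure α ρ) := by
  have h1 := integrable_cellIntegral (α := α) hρ
    (measurable_indicator_one (measurableSet_Iic (a := (1 : ℝ))))
    (fun s => by unfold Set.indicator; split_ifs <;> simp) 0
  have hev := (hasLaw_eval_jumpMeasure (α := α) (ρ := ρ) 0)
  rw [← hev.map_eq] at h1
  have h2 := h1.comp_aemeasurable hev.aemeasurable
  refine h2.congr (ae_of_all _ fun ω => ?_)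
  simp [jumpProcess, jumpIntegral]

lemma integrable_log_one_add_abs {Ω : Type*} [MeasurableSpace Ω] {P : Measure Ω} {X : Ω → ℝ}
    (hX : Integrable X P) : Integrable (fun ω => Real.log (1 + |X ω|)) P := by
  refine hX.abs.mono' ?_ (ae_of_all _ fun ω => ?_)
  · have := hX.aemeasurable
    exact AEMeasurable.aestronglyMeasurable (by fun_prop)
  · have h0 := abs_nonneg (X ω)
    rw [Real.norm_of_nonneg (Real.log_nonneg (by linarith))]
    have := Real.log_le_sub_one_of_pos (x := 1 + |X ω|) (by linarith)
    linarith

end CompoundPoissonProcess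

/-! ### The exponential integral of the process has the gamma law. -/

section RandomIntegral

lemma integral_exp_neg_mul_indicator {τ T : ℝ} (hτ : 0 < τ) (hT : 0 ≤ T) :
    ∫ s in (0 : ℝ)..T, Real.exp (-s) * (Set.Iic s).indicator (fun _ => 1) τ =
      (Real.exp (-τ) - Real.exp (-T)) * (Set.Iic T).indicator (fun _ => 1) τ := by
  have h1 : ∀ s : ℝ, Real.exp (-s) * (Set.Iic s).indicator (fun _ => 1) τ =
      (Set.Ici τ).indicator (fun s => Real.exp (-s)) s := fun s => by
    simp [Set.indicator]
  simp_rw [h1]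
  rw [intervalIntegral.integral_of_le hT, setIntegral_indicator measurableSet_Ici]
  have h2 : Set.Ioc 0 T ∩ Set.Ici τ = Set.Icc τ T := by
    ext s
    simp only [Set.mem_inter_iff, Set.mem_Ioc, Set.mem_Ici, Set.mem_Icc]
    exact ⟨fun h => ⟨h.2, h.1.2⟩, fun h => ⟨⟨hτ.trans_le h.1, h.2⟩, h.1⟩⟩
  rw [h2]
  rcases le_or_gt τ T with h | h
  · rw [integral_Icc_eq_integral_Ioc, ← intervalIntegral.integral_of_le h, integral_exp_neg_eq]
    simp [h]
  · simp [not_le.2 h]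

lemma intervalIntegrable_exp_neg_mul_indicator (τ a b : ℝ) :
    IntervalIntegrable (fun s => Real.exp (-s) * (Set.Iic s).indicator (fun _ => 1) τ)
      volume a b := by
  have h1 : ∀ s : ℝ, Real.exp (-s) * (Set.Iic s).indicator (fun _ => 1) τ =
      (Set.Ici τ).indicator (fun s => Real.exp (-s)) s := fun s => by
    simp [Set.indicator]
  simp_rw [h1]
  have h2 : IntervalIntegrable (fun s => Real.exp (-s)) volume a b :=
    Continuous.intervalIntegrable (by fun_prop) _ _
  exact ⟨h2.1.indicator measurableSet_Ici, h2.2.indicator measurableSet_Ici⟩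

/-- The integral of `e^{-s}` over `(0, T]` with respect to a compound Poisson process. -/
noncomputable def expJumpIntegral (T : ℝ) (ω : ℕ → JumpCell) : ℝ :=
  jumpIntegral (fun s => Real.exp (-s) * (Set.Iic T).indicator (fun _ => 1) s) ⌈T⌉₊ ω

variable {ω : ℕ → JumpCell}

lemma expJumpIntegral_eq (hω : JumpsInCells ω) {T : ℝ} {M : ℕ} (hM : T ≤ M) :
    expJumpIntegral T ω =
      jumpIntegral (fun s => Real.exp (-s) * (Set.Iic T).indicator (fun _ => 1) s) M ω := by
  refine (jumpIntegral_eq_of_le hω (Nat.ceil_le.2 hM) fun s hs => ?_).symm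
  rw [Set.indicator_of_notMem (fun hs' => ?_), mul_zero]
  exact absurd (Set.mem_Iic.1 hs') (not_le.2 ((Nat.le_ceil T).trans_lt hs))

/-- For a jump at `τ ≤ T` the boundary term gives `e^{-T}` and the time integral `e^{-τ} - e^{-T}`,
together `e^{-τ}`; by linearity one jump at a time suffices. -/
lemma expRandomIntegral_jumpProcess (hω : JumpsInCells ω) {T : ℝ} (hT : 0 ≤ T) :
    expRandomIntegral jumpProcess T ω = expJumpIntegral T ω := by
  have hM := Nat.le_ceil T
  have h1 : ∀ s ∈ Set.Icc 0 T, jumpProcess s.toNNReal ω =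
      jumpIntegral ((Set.Iic s).indicator fun _ => 1) ⌈T⌉₊ ω := fun s hs => by
    rw [jumpProcess_eq hω (M := ⌈T⌉₊), Real.coe_toNNReal _ hs.1]
    rw [Real.toNNReal_le_iff_le_coe]
    exact_mod_cast hs.2.trans hM
  have h2 : ∫ s in (0 : ℝ)..T, Real.exp (-s) * jumpProcess s.toNNReal ω =
      ∑ n ∈ Finset.range ⌈T⌉₊, ∑ k ∈ Finset.range (ω n).1,
        (Real.exp (-(n + ((ω n).2 k).1)) - Real.exp (-T)) *
          (Set.Iic T).indicator (fun _ => 1) (n + ((ω n).2 k).1) * ((ω n).2 k).2 := by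
    have h3 : ∫ s in (0 : ℝ)..T, Real.exp (-s) * jumpProcess s.toNNReal ω =
        ∫ s in (0 : ℝ)..T, ∑ n ∈ Finset.range ⌈T⌉₊, ∑ k ∈ Finset.range (ω n).1,
          Real.exp (-s) * (Set.Iic s).indicator (fun _ => 1) (n + ((ω n).2 k).1) *
            ((ω n).2 k).2 := by
      refine intervalIntegral.integral_congr fun s hs => ?_
      rw [Set.uIcc_of_le hT] at hs
      simp only [h1 s hs, jumpIntegral, cellIntegral, Finset.mul_sum, mul_assoc]
    have hii : ∀ n k : ℕ, IntervalIntegrable (fun s => Real.exp (-s) *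
        (Set.Iic s).indicator (fun _ => 1) (n + ((ω n).2 k).1) * ((ω n).2 k).2) volume 0 T :=
      fun n k => (intervalIntegrable_exp_neg_mul_indicator _ _ _).mul_const _
    have hin : ∀ n : ℕ, IntervalIntegrable (fun s => ∑ k ∈ Finset.range (ω n).1, Real.exp (-s) *
        (Set.Iic s).indicator (fun _ => 1) (n + ((ω n).2 k).1) * ((ω n).2 k).2) volume 0 T :=
      fun n => by
        have := IntervalIntegrable.sum (Finset.range (ω n).1) fun k _ => hii n k
        rwa [Finset.sum_fn] at this
    rw [h3, intervalIntegral.integral_finsetSum fun n _ => hin n]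
    refine Finset.sum_congr rfl fun n _ => ?_
    rw [intervalIntegral.integral_finsetSum fun k _ => hii n k]
    refine Finset.sum_congr rfl fun k _ => ?_
    rw [intervalIntegral.integral_mul_const, integral_exp_neg_mul_indicator
      (add_pos_of_nonneg_of_pos n.cast_nonneg (hω n k).1) hT]
  rw [expRandomIntegral, jumpProcess_zero, sub_zero, h2, h1 T ⟨hT, le_rfl⟩, expJumpIntegral]
  simp only [jumpIntegral, cellIntegral, Finset.mul_sum, ← Finset.sum_add_distrib]
  refine Finset.sum_congr rfl fun n _ => Finset.sum_congr rfl fun k _ => ?_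
  ring

lemma expJumpIntegral_natCast (hω : JumpsInCells ω) (M : ℕ) :
    expJumpIntegral M ω = jumpIntegral (fun s => Real.exp (-s)) M ω := by
  rw [expJumpIntegral_eq hω le_rfl]
  refine jumpIntegral_congr hω fun s _ hs => ?_
  simp [hs]

/-- Monotonicity reduces the limit over real `T` to integer `T`, where partial sums over whole cells
appear. -/
lemma monotone_expJumpIntegral (hω : JumpsInCells ω) (hpos : ∀ n k, 0 ≤ ((ω n).2 k).2) :
    Monotone fun T => expJumpIntegral T ω := by
  intro T T' hT
  have hM := Nat.le_ceil T'
  change expJumpIntegral T ω ≤ expJumpIntegral T' ω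
  rw [expJumpIntegral_eq hω hM, expJumpIntegral_eq hω (hT.trans hM)]
  refine Finset.sum_le_sum fun n _ => Finset.sum_le_sum fun k _ => ?_
  refine mul_le_mul_of_nonneg_right (mul_le_mul_of_nonneg_left ?_ (Real.exp_pos _).le) (hpos n k)
  exact Set.indicator_le_indicator_of_subset (Set.Iic_subset_Iic.2 hT) (fun _ => zero_le_one) _

lemma tendsto_expRandomIntegral_jumpProcess (hω : JumpsInCells ω)
    (hpos : ∀ n k, 0 ≤ ((ω n).2 k).2)
    (hsum : Summable fun n => cellIntegral (fun s => Real.exp (-s)) n (ω n)) :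
    Tendsto (fun T => expRandomIntegral jumpProcess T ω) atTop
      (𝓝 (∑' n, cellIntegral (fun s => Real.exp (-s)) n (ω n))) := by
  have h1 : Tendsto (fun T => expJumpIntegral T ω) atTop
      (𝓝 (∑' n, cellIntegral (fun s => Real.exp (-s)) n (ω n))) := by
    rw [tendsto_iff_tendsto_subseq_of_monotone (monotone_expJumpIntegral hω hpos)
      tendsto_natCast_atTop_atTop]
    refine hsum.hasSum.tendsto_sum_nat.congr fun M => ?_
    exact (expJumpIntegral_natCast hω M).symm
  refine h1.congr' ?_
  filter_upwards [eventually_ge_atTop 0] with T hT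
  exact (expRandomIntegral_jumpProcess hω hT).symm

variable {α : ℝ≥0} {ρ : Measure ℝ} [IsProbabilityMeasure ρ]

/-- Cell `n` contributes at most `e^{-n}` times its total jump size; these sizes share one finite
mean, so the dominating series has finite expectation. -/
lemma ae_summable_cellIntegral_exp (hρ : Integrable id ρ) (hρ0 : ∀ᵐ x ∂ρ, 0 ≤ x) :
    ∀ᵐ ω ∂(jumpMeasure α ρ),
      Summable fun n => cellIntegral (fun s => Real.exp (-s)) n (ω n) := by
  set g : JumpCell → ℝ := cellIntegral (fun _ => 1) 0 with hg
  have hgm : Measurable g := measurable_cellIntegral measurable_const 0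
  have hgn : ∀ n, Measurable fun ω : ℕ → JumpCell => g (ω n) := fun n =>
    hgm.comp (measurable_pi_apply n)
  have hgi : Integrable g (jumpCellMeasure α ρ) :=
    integrable_cellIntegral hρ measurable_const (by simp) 0
  have hterm : ∀ n : ℕ, ∫⁻ ω, ENNReal.ofReal (Real.exp (-n)) * ‖g (ω n)‖ₑ ∂(jumpMeasure α ρ) =
      ENNReal.ofReal (Real.exp (-n)) * ∫⁻ c, ‖g c‖ₑ ∂(jumpCellMeasure α ρ) := fun n => by
    rw [lintegral_const_mul _ (hgn n).enorm,
      (hasLaw_eval_jumpMeasure n).lintegral_comp (f := fun c => ‖g c‖ₑ) hgm.enorm.aemeasurable]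
  have hexp : Summable fun n : ℕ => Real.exp (-n) := Real.summable_exp_neg_nat
  have hfin : ∫⁻ ω, ∑' n : ℕ, ENNReal.ofReal (Real.exp (-n)) * ‖g (ω n)‖ₑ ∂(jumpMeasure α ρ) ≠
      ⊤ := by
    rw [lintegral_tsum fun n => ((hgn n).enorm.const_mul _).aemeasurable]
    simp_rw [hterm]
    rw [ENNReal.tsum_mul_right]
    exact ENNReal.mul_ne_top hexp.tsum_ofReal_ne_top hgi.2.ne
  have hm : Measurable fun ω : ℕ → JumpCell =>
      ∑' n : ℕ, ENNReal.ofReal (Real.exp (-n)) * ‖g (ω n)‖ₑ :=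
    Measurable.tsum fun n => (hgn n).enorm.const_mul _
  filter_upwards [ae_lt_top hm hfin, ae_jumpsInCells, ae_jump_nonneg hρ0] with ω hlt hω hpos
  have hs := ENNReal.summable_toReal hlt.ne
  refine hs.of_nonneg_of_le (fun n => ?_) fun n => ?_
  · exact Finset.sum_nonneg fun k _ => mul_nonneg (Real.exp_pos _).le (hpos n k)
  · rw [ENNReal.toReal_mul, ENNReal.toReal_ofReal (Real.exp_pos _).le, toReal_enorm, hg]
    refine le_trans ?_ (mul_le_mul_of_nonneg_left (le_abs_self _) (Real.exp_pos _).le)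
    rw [cellIntegral, cellIntegral, Finset.mul_sum]
    refine Finset.sum_le_sum fun k _ => ?_
    rw [one_mul]
    refine mul_le_mul_of_nonneg_right (Real.exp_le_exp.2 ?_) (hpos n k)
    have := (hω n k).1
    linarith

lemma integral_charFun_expMeasure {r : ℝ} (hr : 0 < r) (u : ℝ) (M : ℕ) :
    ∫ s in (0 : ℝ)..M, (charFun (expMeasure r) (u * Real.exp (-s)) - 1) =
      Complex.log (1 - (Real.exp (-M) * u : ℝ) * Complex.I / r) -
        Complex.log (1 - u * Complex.I / r) := by
  have := isProbabilityMeasure_expMeasure hr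
  have hd : ∀ s ∈ Set.uIcc (0 : ℝ) M, HasDerivAt
      (fun s : ℝ => Complex.log (1 - (Real.exp (-s) * u : ℝ) * Complex.I / r))
      (charFun (expMeasure r) (u * Real.exp (-s)) - 1) s := by
    intro s _
    have h1 := (hasDerivAt_log_one_sub_exp hr u (-s)).scomp s (hasDerivAt_neg s)
    refine h1.congr_deriv ?_
    rw [charFun_expMeasure hr, mul_comm u]
    simp
  rw [intervalIntegral.integral_eq_sub_of_hasDerivAt hd
    ((intervalIntegrable_charFun_comp (by fun_prop) _ _).sub intervalIntegrable_const)]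
  simp

theorem isBDLP_jumpProcess {r : ℝ} (hα : 0 < α) (hr : 0 < r) :
    IsBDLP jumpProcess (jumpMeasure α (expMeasure r)) (gammaMeasure α r) := by
  have := isProbabilityMeasure_expMeasure hr
  have hα' : (0 : ℝ) < α := hα
  have := isProbabilityMeasure_gammaMeasure hα' hr
  have hint : Integrable id (expMeasure r) := integrable_id_gammaMeasure one_pos hr
  have h0 : ∀ᵐ x ∂(expMeasure r), 0 ≤ x := ae_nonneg_gammaMeasure
  have hem : Measurable fun s : ℝ => Real.exp (-s) := by fun_prop
  refine ⟨isLevyProcess_jumpProcess, integrable_log_one_add_abs (integrable_jumpProcess_one hint),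
    fun ω => ∑' n, cellIntegral (fun s => Real.exp (-s)) n (ω n), ?_, ?_⟩
  · have hlim : ∀ᵐ ω ∂(jumpMeasure α (expMeasure r)),
        Tendsto (fun M => jumpIntegral (fun s => Real.exp (-s)) M ω) atTop
          (𝓝 (∑' n, cellIntegral (fun s => Real.exp (-s)) n (ω n))) := by
      filter_upwards [ae_summable_cellIntegral_exp hint h0] with ω hω
      exact hω.hasSum.tendsto_sum_nat
    have hX := aemeasurable_of_tendsto_metrizable_ae atTop
      (fun M => (measurable_jumpIntegral hem M).aemeasurable) hlim
    have := Measure.isProbabilityMeasure_map hX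
    refine ⟨hX, Measure.ext_of_charFun (funext fun u => ?_)⟩
    rw [charFun_map_eq_phaseMean hX]
    have h1 := tendsto_phaseMean
      (fun M => (measurable_jumpIntegral hem M).aemeasurable.const_mul u)
      (hlim.mono fun ω hω => hω.const_mul u)
    have h2 : ∀ M, phaseMean (jumpMeasure α (expMeasure r))
        (fun ω => u * jumpIntegral (fun s => Real.exp (-s)) M ω) =
        Complex.exp (α * (Complex.log (1 - (Real.exp (-M) * u : ℝ) * Complex.I / r) -
          Complex.log (1 - u * Complex.I / r))) := fun M => by
      rw [← integral_charFun_expMeasure hr, ← phaseMean_jumpIntegral (hem.const_mul u)]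
      simp_rw [← jumpIntegral_const_mul]
    refine tendsto_nhds_unique h1 ?_
    simp_rw [h2]
    -- The logarithm at the upper endpoint tends to `log 1 = 0`, leaving the exponent of the gamma
    -- law.
    have h3 : Tendsto (fun M : ℕ => (1 - (Real.exp (-M) * u : ℝ) * Complex.I / r : ℂ)) atTop
        (𝓝 1) := by
      have h4 : Tendsto (fun M : ℕ => Real.exp (-M) * u) atTop (𝓝 (0 * u)) :=
        (Real.tendsto_exp_neg_atTop_nhds_zero.comp tendsto_natCast_atTop_atTop).mul_const u
      have h5 := (((Complex.continuous_ofReal.tendsto _).comp h4).mul_const Complex.I).div_const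
        (r : ℂ) |>.const_sub 1
      simpa using! h5
    have h6 := ((h3.clog (by simp)).sub_const (Complex.log (1 - u * Complex.I / r))).const_mul
      (α : ℂ) |>.cexp
    rw [charFun_gammaMeasure hα' hr]
    simpa using! h6
  · filter_upwards [ae_jumpsInCells, ae_jump_nonneg h0, ae_summable_cellIntegral_exp hint h0]
      with ω hω hpos hsum
    exact tendsto_expRandomIntegral_jumpProcess hω hpos hsum

end RandomIntegral

/-! ### Identification of `Y(1)` and the explicit inversion integrand. -/

section BackgroundDriving

variable {Ω : Type*} [MeasurableSpace Ω] {P : Measure Ω} [IsProbabilityMeasure P]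
  {N : Ω → ℕ} {E : ℕ → Ω → ℝ} {α : ℝ≥0} {r : ℝ}

lemma charFun_map_randomSum_exponential (hr : 0 < r) (hN : HasLaw N (poissonMeasure α) P)
    (hE : ∀ k, HasLaw (E k) (expMeasure r) P) (hE_indep : iIndepFun E P)
    (hNE : IndepFun N (fun ω k => E k ω) P) (u : ℝ) :
    charFun (P.map (randomSum N E)) u =
      Complex.exp ((α : ℝ) * ((1 - u * Complex.I / r)⁻¹ - 1)) := by
  have hEm : ∀ k, AEMeasurable (E k) P := fun k => (hE k).aemeasurable
  rw [charFun_map_eq_phaseMean (aemeasurable_randomSum hN.aemeasurable hEm)]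
  have hmul : (fun ω => u * randomSum N E ω) = randomSum N (fun k ω => u * E k ω) := by
    ext ω
    simp [randomSum, Finset.mul_sum]
  have hNE' : IndepFun N (fun ω k => u * E k ω) P :=
    hNE.comp measurable_id
      (by fun_prop : Measurable fun (e : ℕ → ℝ) (k : ℕ) => u * e k)
  rw [hmul, phaseMean_randomSum hN (fun k => (hEm k).const_mul u)
    (hE_indep.comp (fun _ x => u * x) fun _ => by fun_prop) hNE'
    fun k => phaseMean_eq_charFun (hE k) u, charFun_expMeasure hr]

lemma integrable_randomSum_exponential (hr : 0 < r) (hN : HasLaw N (poissonMeasure α) P)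
    (hE : ∀ k, HasLaw (E k) (expMeasure r) P) (hNE : IndepFun N (fun ω k => E k ω) P) :
    Integrable (randomSum N E) P := by
  have hfin : ∫⁻ x, ‖x‖ₑ ∂(expMeasure r) ≠ ⊤ := (integrable_id_gammaMeasure one_pos hr).2.ne
  refine integrable_randomSum hN (fun k => (hE k).aemeasurable) hNE
    (C := (∫⁻ x, ‖x‖ₑ ∂(expMeasure r)).toNNReal) fun k => ?_
  rw [ENNReal.coe_toNNReal hfin,
    ← (hE k).lintegral_comp (f := fun x => ‖x‖ₑ) measurable_enorm.aemeasurable]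

lemma IsBDLP.identDistrib_randomSum {Ω' : Type*} [MeasurableSpace Ω'] {P' : Measure Ω'}
    [IsProbabilityMeasure P'] {Y : ℝ≥0 → Ω' → ℝ} (hα : 0 < α) (hr : 0 < r)
    (hY : IsBDLP Y P' (gammaMeasure α r)) (hN : HasLaw N (poissonMeasure α) P)
    (hE : ∀ k, HasLaw (E k) (expMeasure r) P) (hE_indep : iIndepFun E P)
    (hNE : IndepFun N (fun ω k => E k ω) P) :
    IdentDistrib (Y 1) (randomSum N E) P' P := by
  have h1 := (hY.isLevyProcess.measurable 1).aemeasurable (μ := P')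
  have h2 := aemeasurable_randomSum hN.aemeasurable fun k => (hE k).aemeasurable
  have := Measure.isProbabilityMeasure_map h1
  have := Measure.isProbabilityMeasure_map h2
  refine ⟨h1, h2, Measure.ext_of_charFun (funext fun u => ?_)⟩
  rw [hY.charFun_gammaMeasure (NNReal.coe_pos.2 hα) hr, charFun_map_randomSum_exponential hr hN hE hE_indep hNE]

/-- The atom at `a` is at most `F(a) - F(x)` for every `x < a`. -/
lemma measure_singleton_eq_zero_of_continuousAt {μ : Measure ℝ} [IsFiniteMeasure μ] {a : ℝ}
    (h : ContinuousAt (fun x => μ.real (Set.Iic x)) a) : μ {a} = 0 := by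
  rw [← measureReal_eq_zero_iff]
  refine le_antisymm ?_ measureReal_nonneg
  have hlim : Tendsto (fun x => μ.real (Set.Iic a) - μ.real (Set.Iic x)) (𝓝[<] a) (𝓝 0) := by
    simpa using! (h.tendsto.mono_left nhdsWithin_le_nhds).const_sub (μ.real (Set.Iic a))
  refine ge_of_tendsto hlim ?_
  filter_upwards [self_mem_nhdsWithin] with x hx
  have hdisj : Disjoint (Set.Iic x) {a} := by simpa using hx
  have hsub : Set.Iic x ∪ {a} ⊆ Set.Iic a :=
    Set.union_subset (Set.Iic_subset_Iic.2 (Set.mem_Iio.1 hx).le) (by simp)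
  have := measureReal_mono (μ := μ) hsub
  rw [measureReal_union hdisj (measurableSet_singleton a)] at this
  linarith

/-- With `x = t/r`, `(1 - ix)⁻¹ = (1 + ix)/(1 + x²)` separates damping from phase. -/
lemma im_exp_mul_compoundPoisson_charFun (c r t a : ℝ) :
    (Complex.exp (-(t * a : ℝ) * Complex.I) *
      Complex.exp (c * ((1 - t * Complex.I / r)⁻¹ - 1))).im =
      -(Real.exp (-(c * (t / r) ^ 2 / (1 + (t / r) ^ 2))) *
        Real.sin (t * a - c * (t / r) / (1 + (t / r) ^ 2))) := by
  set x : ℝ := t / r with hx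
  have hpos : 0 < 1 + x ^ 2 := by positivity
  have hc : (1 + (x : ℂ) ^ 2) ≠ 0 := by exact_mod_cast hpos.ne'
  have hfac : (1 - (x : ℂ) * Complex.I) * (1 + x * Complex.I) = 1 + (x : ℂ) ^ 2 := by
    linear_combination (-(x : ℂ) ^ 2) * Complex.I_sq
  have hinv : (1 - t * Complex.I / r : ℂ)⁻¹ = (1 + x * Complex.I) / (1 + (x : ℂ) ^ 2) := by
    have h1 : (1 - t * Complex.I / r : ℂ) = 1 - x * Complex.I := by
      rw [hx]
      push_cast
      ring
    rw [h1]
    refine inv_eq_of_mul_eq_one_right ?_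
    rw [mul_div_assoc', hfac, div_self hc]
  have harg : -(t * a : ℝ) * Complex.I + c * ((1 - t * Complex.I / r)⁻¹ - 1) =
      (-(c * x ^ 2 / (1 + x ^ 2)) : ℝ) +
        (-(t * a - c * x / (1 + x ^ 2)) : ℝ) * Complex.I := by
    rw [hinv]
    push_cast
    field_simp
    ring
  rw [← Complex.exp_add, harg, Complex.exp_add, ← Complex.ofReal_exp, Complex.im_ofReal_mul,
    Complex.exp_ofReal_mul_I_im, Real.sin_neg, mul_neg]

lemma HasImproperIntegral.neg {f : ℝ → ℝ} {L : ℝ} (h : HasImproperIntegral f L) :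
    HasImproperIntegral (fun t => -f t) (-L) :=
  ⟨fun T hT => (h.1 T hT).neg, by simpa only [intervalIntegral.integral_neg] using h.2.neg⟩

end BackgroundDriving

theorem lemma1 {Ω Ω' : Type*} [MeasurableSpace Ω] [MeasurableSpace Ω']
    (P : Measure Ω) [IsProbabilityMeasure P]
    (α lam : ℝ) (hα : 0 < α) (hlam : 0 < lam)
    (N : Ω → ℕ) (E : ℕ → Ω → ℝ)
    (hN : HasLaw N (poissonMeasure α.toNNReal) P)
    (hE : ∀ k, HasLaw (E k) (expMeasure lam) P)
    (hE_indep : iIndepFun E P)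
    (hNE_indep : IndepFun N (fun ω k => E k ω) P) :
    IsBDRV (randomSum N E) P (gammaMeasure α lam) ∧
    ∀ (P' : Measure Ω') [IsProbabilityMeasure P'] (Y : ℝ≥0 → Ω' → ℝ),
      IsBDLP Y P' (gammaMeasure α lam) →
        IdentDistrib (Y 1) (randomSum N E) P' P ∧
        ∀ a : ℝ, ContinuousAt (bddf Y P') a →
          bddf Y P' a = P.real {ω | randomSum N E ω ≤ a} ∧
          (∃ L : ℝ,
            HasImproperIntegral
              (fun t => Real.exp (-(α * (t / lam) ^ 2 / (1 + (t / lam) ^ 2))) *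
                Real.sin (t * a - α * (t / lam) / (1 + (t / lam) ^ 2)) * (1 / t)) L ∧
            bddf Y P' a = 1 / 2 + 1 / Real.pi * L) ∧
          (0 < a →
            bddf Y P' a = Real.exp (-α) + Real.exp (-α) *
              ∫ w in (0 : ℝ)..(2 * √(α * lam * a)),
                besselI 1 w * Real.exp (-(w ^ 2 / (4 * α)))) := by
  lift α to ℝ≥0 using hα.le
  have hα' : 0 < α := hα
  rw [Real.toNNReal_coe] at hN
  have := isProbabilityMeasure_expMeasure hlam
  refine ⟨⟨ℕ → JumpCell, inferInstance, jumpMeasure α (expMeasure lam), inferInstance, jumpProcess,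
    isBDLP_jumpProcess hα' hlam, ((isBDLP_jumpProcess hα' hlam).identDistrib_randomSum hα' hlam
      hN hE hE_indep hNE_indep).symm⟩, fun P' _ Y hY => ?_⟩
  have hid := hY.identDistrib_randomSum hα' hlam hN hE hE_indep hNE_indep
  refine ⟨hid, fun a ha => ?_⟩
  have hYm := (hY.isLevyProcess.measurable 1).aemeasurable (μ := P')
  have := Measure.isProbabilityMeasure_map hYm
  have hbddf : bddf Y P' = fun x => (P'.map (Y 1)).real (Set.Iic x) := funext fun x =>
    (map_measureReal_apply (hY.isLevyProcess.measurable 1) measurableSet_Iic).symm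
  have hsum : bddf Y P' a = P.real {ω | randomSum N E ω ≤ a} :=
    congrArg ENNReal.toReal (hid.measure_mem_eq measurableSet_Iic)
  -- The Gil-Pelaez value with its sign reversed, since the integrand here is minus the imaginary
  -- part occurring there.
  refine ⟨hsum, ⟨-(Real.pi / 2 - Real.pi * bddf Y P' a), ?_, ?_⟩, fun ha0 => ?_⟩
  · have hint : Integrable id (P'.map (Y 1)) := by
      rw [hid.map_eq, integrable_map_measure aestronglyMeasurable_id hid.aemeasurable_snd]
      exact integrable_randomSum_exponential hlam hN hE hNE_indep
    have hgp := (gilPelaez hint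
      (measure_singleton_eq_zero_of_continuousAt (hbddf ▸ ha))).neg
    simp_rw [hY.charFun_gammaMeasure hα hlam, im_exp_mul_compoundPoisson_charFun, neg_mul,
      neg_neg] at hgp
    rwa [hbddf]
  · have := Real.pi_pos
    field_simp
    ring
  · rw [hsum, measureReal_randomSum_le hα hlam (by rwa [Real.toNNReal_coe]) hE hE_indep hNE_indep ha0.le]
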